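/- Let $q\in L^1_{loc}(\mathbb R)$ be real valued and even, such that $\tau_q(y):=-y''-qy$ is in the limit circle case at $+\infty$ and at $-\infty$ (all solutions $y$ of $\tau_q(y)=\lambda y$, $\lambda\in\mathbb C$, are square integrable near $+\infty$ and near $-\infty$). Let $\mathcal D_{\max}=\{y\in L^2(\mathbb R): y,y'\in AC_{loc}(\mathbb R),\ \tau_q y\in L^2(\mathbb R)\}$, let $A_{\max}y=\tau_q(y)$ for $y\in\mathcal D_{\max}$, and let $A$ be the minimal operator, i.e. the closure in $L^2(\mathbb R)$ of the restriction of $A_{\max}$ to the functions of compact support in $\mathcal D_{\max}$. For $r\in\mathbb N$, an $r$-dimensional extension of $A$ is a closed operator $\widetilde A$ with $A\subset\widetilde A\subset A^*$ and $\dim(\operatorname{dom}\widetilde A/\operatorname{dom}A)=r$. Put $[f,g]_x=\overline{f(x)}g'(x)-\overline{f'(x)}g(x)$ and $[f,g]_{\pm\infty}=\lim_{x\to\pm\infty}[f,g]_x$ (the limits exist for $f,g\in\mathcal D_{\max}$). Let $w_1,w_2\in\mathcal D_{\max}$ be real valued solutions of $\tau_q(y)=0$, $w_1$ odd and $w_2$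 even, with $[w_1,w_2]_{\pm\infty}=1$ and $[w_1,w_1]_{\pm\infty}=[w_2,w_2]_{\pm\infty}=0$. For $f\in\mathcal D_{\max}$ put $\alpha_j(f)=[w_j,f]_{-\infty}$ and $\beta_j(f)=[w_j,f]_{\infty}$, $j=1,2$. Let $(\mathcal Pf)(x)=f(-x)$, and let $T^+:=\mathcal P T^*\mathcal P$ be the adjoint of a densely defined operator $T$ in the Krein space $L^2(\mathbb R)$ with the inner product $[f,g]=\int_{\mathbb R} f\,\overline{\mathcal P g}\,dx$. Let $\widetilde A$ be a $3$-dimensional extension of $A$ with domain $$\operatorname{dom}\widetilde A=\{f\in\mathcal D_{\max}: a\alpha_1(f)+b\alpha_2(f)=c\beta_1(f)+d\beta_2(f)\},$$ where $a,b,c,d\in\mathbb C$, $|a|+|b|+|c|+|d|\neq0$. Then $\widetilde A^*$ and $\widetilde A^+$ are $1$-dimensional extensions of $A$, and: (1) If $a\ne0$, then $\operatorname{dom}\widetilde A^*$ is the set of all $g\in\mathcal D_{\max}$ with $$\overline a\,\alpha_1(g)+\overline b\,\alpha_2(g)=0,\qquad \begin{bmatrix}0&-\overline d/\overline a\\0&\overline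 c/\overline a\end{bmatrix}\begin{pmatrix}\alpha_1(g)\\ \alpha_2(g)\end{pmatrix}=\begin{pmatrix}\beta_1(g)\\ \beta_2(g)\end{pmatrix},$$ and $\operatorname{dom}\widetilde A^+$ is the set of all $h\in\mathcal D_{\max}$ with $$\overline a\,\beta_1(h)-\overline b\,\beta_2(h)=0,\qquad \begin{bmatrix}0&\overline d/\overline a\\0&\overline c/\overline a\end{bmatrix}\begin{pmatrix}\beta_1(h)\\ \beta_2(h)\end{pmatrix}=\begin{pmatrix}\alpha_1(h)\\ \alpha_2(h)\end{pmatrix}.$$ (2) If $b\ne0$, then $\operatorname{dom}\widetilde A^*$ is the set of all $g\in\mathcal D_{\max}$ with $$\overline a\,\alpha_1(g)+\overline b\,\alpha_2(g)=0,\qquad \begin{bmatrix}\overline d/\overline b&0\\-\overline c/\overline b&0\end{bmatrix}\begin{pmatrix}\alpha_1(g)\\ \alpha_2(g)\end{pmatrix}=\begin{pmatrix}\beta_1(g)\\ \beta_2(g)\end{pmatrix},$$ and $\operatorname{dom}\widetilde A^+$ is the set of all $h\in\mathcal D_{\max}$ with $$\overline a\,\beta_1(h)-\overline b\,\beta_2(h)=0,\qquad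 \begin{bmatrix}\overline d/\overline b&0\\ \overline c/\overline b&0\end{bmatrix}\begin{pmatrix}\beta_1(h)\\ \beta_2(h)\end{pmatrix}=\begin{pmatrix}\alpha_1(h)\\ \alpha_2(h)\end{pmatrix}.$$ (3) If $c\ne0$, then $\operatorname{dom}\widetilde A^*$ is the set of all $g\in\mathcal D_{\max}$ with $$\overline c\,\beta_1(g)+\overline d\,\beta_2(g)=0,\qquad \begin{bmatrix}0&-\overline b/\overline c\\0&\overline a/\overline c\end{bmatrix}\begin{pmatrix}\beta_1(g)\\ \beta_2(g)\end{pmatrix}=\begin{pmatrix}\alpha_1(g)\\ \alpha_2(g)\end{pmatrix},$$ and $\operatorname{dom}\widetilde A^+$ is the set of all $h\in\mathcal D_{\max}$ with $$\overline c\,\alpha_1(h)-\overline d\,\alpha_2(h)=0,\qquad \begin{bmatrix}0&\overline b/\overline c\\0&\overline a/\overline c\end{bmatrix}\begin{pmatrix}\alpha_1(h)\\ \alpha_2(h)\end{pmatrix}=\begin{pmatrix}\beta_1(h)\\ \beta_2(h)\end{pmatrix}.$$ (4) If $d\ne0$, then $\operatorname{dom}\widetilde A^*$ is the set of all $g\in\mathcal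 D_{\max}$ with $$\overline c\,\beta_1(g)+\overline d\,\beta_2(g)=0,\qquad \begin{bmatrix}\overline b/\overline d&0\\-\overline a/\overline d&0\end{bmatrix}\begin{pmatrix}\beta_1(g)\\ \beta_2(g)\end{pmatrix}=\begin{pmatrix}\alpha_1(g)\\ \alpha_2(g)\end{pmatrix},$$ and $\operatorname{dom}\widetilde A^+$ is the set of all $h\in\mathcal D_{\max}$ with $$\overline c\,\alpha_1(h)-\overline d\,\alpha_2(h)=0,\qquad \begin{bmatrix}\overline b/\overline d&0\\ \overline a/\overline d&0\end{bmatrix}\begin{pmatrix}\alpha_1(h)\\ \alpha_2(h)\end{pmatrix}=\begin{pmatrix}\beta_1(h)\\ \beta_2(h)\end{pmatrix}.$$ -/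

import Mathlib

open MeasureTheory Filter Topology
open scoped ComplexConjugate LinearPMap

namespace PTExt

noncomputable section

/-- The Hilbert space of (classes of) complex valued square integrable functions on the line. -/
abbrev L2 : Type := Lp ℂ 2 (volume : Measure ℝ)

/-- Absolute continuity on every compact interval. -/
def LocAC (y : ℝ → ℂ) : Prop := ∀ a b : ℝ, AbsolutelyContinuousOnInterval y a b

/-- The differential expression `τ_q y = - y'' - q y`. For `y, y'` locally absolutely continuous
the second derivative exists almost everywhere. -/
def tau (q : ℝ → ℝ) (y : ℝ → ℂ) (x : ℝ) : ℂ := - deriv (deriv y) x - (q x : ℂ) * y x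

/-- `y` is differentiable and `y, y'` are locally absolutely continuous. -/
structure IsRegular (y : ℝ → ℂ) : Prop where
  differentiable : Differentiable ℝ y
  ac : LocAC y
  ac_deriv : LocAC (deriv y)

/-- `y` is a solution of `τ_q y = μ y`. -/
structure IsSolution (q : ℝ → ℝ) (μ : ℂ) (y : ℝ → ℂ) : Prop where
  regular : IsRegular y
  eq : ∀ᵐ x : ℝ, tau q y x = μ * y x

/-- `τ_q` is in the limit circle case at `+∞`. -/
def LimitCircleTop (q : ℝ → ℝ) : Prop :=
  ∀ (μ : ℂ) (y : ℝ → ℂ), IsSolution q μ y →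
    ∃ a : ℝ, MemLp y 2 (volume.restrict (Set.Ioi a))

/-- `τ_q` is in the limit circle case at `-∞`. -/
def LimitCircleBot (q : ℝ → ℝ) : Prop :=
  ∀ (μ : ℂ) (y : ℝ → ℂ), IsSolution q μ y →
    ∃ a : ℝ, MemLp y 2 (volume.restrict (Set.Iio a))

/-- The standing assumptions on the (real valued) potential. -/
structure Admissible (q : ℝ → ℝ) : Prop where
  locInt : LocallyIntegrable q
  even : ∀ x, q (-x) = q x
  top : LimitCircleTop q
  bot : LimitCircleBot q

/-- The functions of the maximal domain: `y ∈ L²`, `y, y' ∈ AC_loc`, `τ_q y ∈ L²`. -/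
structure IsMaxFun (q : ℝ → ℝ) (y : ℝ → ℂ) : Prop where
  regular : IsRegular y
  memLp : MemLp y 2 volume
  memLp_tau : MemLp (tau q y) 2 volume

theorem LocAC.ae_differentiableAt {y : ℝ → ℂ} (h : LocAC y) :
    ∀ᵐ x : ℝ, DifferentiableAt ℝ y x := by
  have h1 : ∀ n : ℕ, ∀ᵐ x : ℝ, x ∈ Set.uIcc (-(n : ℝ)) n → DifferentiableAt ℝ y x := fun n =>
    (h (-(n : ℝ)) n).boundedVariationOn.ae_differentiableAt_of_mem_uIcc
  filter_upwards [ae_all_iff.2 h1] with x hx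
  obtain ⟨n, hn⟩ := exists_nat_ge |x|
  refine hx n ?_
  rw [Set.mem_uIcc]
  exact Or.inl (abs_le.1 hn)

theorem IsRegular.zero : IsRegular (0 : ℝ → ℂ) := by
  have h0 : deriv (0 : ℝ → ℂ) = 0 := by
    funext x; exact deriv_const x (0 : ℂ)
  have h1 : LocAC (0 : ℝ → ℂ) := fun a b => by
    simpa [AbsolutelyContinuousOnInterval] using tendsto_const_nhds
  exact ⟨differentiable_const 0, h1, by rw [h0]; exact h1⟩

theorem IsRegular.add {y z : ℝ → ℂ} (hy : IsRegular y) (hz : IsRegular z) :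
    IsRegular (y + z) := by
  have h : deriv (y + z) = deriv y + deriv z := by
    funext x; exact deriv_add (hy.differentiable x) (hz.differentiable x)
  exact ⟨hy.differentiable.add hz.differentiable, fun a b => (hy.ac a b).add (hz.ac a b),
    by rw [h]; exact fun a b => (hy.ac_deriv a b).add (hz.ac_deriv a b)⟩

theorem IsRegular.smul {y : ℝ → ℂ} (c : ℂ) (hy : IsRegular y) : IsRegular (c • y) := by
  have h : deriv (c • y) = c • deriv y := by
    funext x; exact deriv_const_smul c (hy.differentiable x)
  exact ⟨hy.differentiable.const_smul c, fun a b => (hy.ac a b).const_smul c,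
    by rw [h]; exact fun a b => (hy.ac_deriv a b).const_smul c⟩

theorem tau_zero (q : ℝ → ℝ) : tau q 0 = 0 := by
  have h0 : deriv (0 : ℝ → ℂ) = 0 := by
    funext x; exact deriv_const x (0 : ℂ)
  funext x
  simp [tau, h0]

theorem tau_add (q : ℝ → ℝ) {y z : ℝ → ℂ} (hy : IsRegular y) (hz : IsRegular z) :
    tau q (y + z) =ᵐ[volume] tau q y + tau q z := by
  have h : deriv (y + z) = deriv y + deriv z := by
    funext x; exact deriv_add (hy.differentiable x) (hz.differentiable x)
  filter_upwards [hy.ac_deriv.ae_differentiableAt, hz.ac_deriv.ae_differentiableAt] with x h1 h2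
  have h3 : deriv (deriv y + deriv z) x = deriv (deriv y) x + deriv (deriv z) x :=
    deriv_add h1 h2
  simp only [tau, h, h3, Pi.add_apply]
  ring

theorem tau_smul (q : ℝ → ℝ) (c : ℂ) {y : ℝ → ℂ} (hy : IsRegular y) :
    tau q (c • y) =ᵐ[volume] c • tau q y := by
  have h : deriv (c • y) = c • deriv y := by
    funext x; exact deriv_const_smul c (hy.differentiable x)
  filter_upwards [hy.ac_deriv.ae_differentiableAt] with x h1
  have h3 : deriv (c • deriv y) x = c • deriv (deriv y) x := deriv_const_smul c h1
  simp only [tau, h, h3, Pi.smul_apply, smul_eq_mul]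
  ring

/-- The graph of the maximal operator, a subspace of `L² × L²`. -/
def maxGraph (q : ℝ → ℝ) : Submodule ℂ (L2 × L2) where
  carrier := {p | ∃ y : ℝ → ℂ, IsMaxFun q y ∧ p.1 =ᵐ[volume] y ∧ p.2 =ᵐ[volume] tau q y}
  zero_mem' := by
    refine ⟨0, ⟨IsRegular.zero, MemLp.zero, by rw [tau_zero]; exact MemLp.zero⟩, ?_, ?_⟩
    · exact Lp.coeFn_zero _ _ _
    · rw [tau_zero]; exact Lp.coeFn_zero _ _ _
  add_mem' := by
    rintro p r ⟨y, hy, hy1, hy2⟩ ⟨z, hz, hz1, hz2⟩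
    refine ⟨y + z, ⟨hy.regular.add hz.regular, hy.memLp.add hz.memLp,
      (memLp_congr_ae (tau_add q hy.regular hz.regular)).2 (hy.memLp_tau.add hz.memLp_tau)⟩,
      ?_, ?_⟩
    · exact (Lp.coeFn_add _ _).trans (hy1.add hz1)
    · exact ((Lp.coeFn_add _ _).trans (hy2.add hz2)).trans
        (tau_add q hy.regular hz.regular).symm
  smul_mem' := by
    rintro c p ⟨y, hy, hy1, hy2⟩
    refine ⟨c • y, ⟨hy.regular.smul c, hy.memLp.const_smul c,
      (memLp_congr_ae (tau_smul q c hy.regular)).2 (hy.memLp_tau.const_smul c)⟩, ?_, ?_⟩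
    · exact (Lp.coeFn_smul _ _).trans (hy1.const_smul c)
    · exact ((Lp.coeFn_smul _ _).trans (hy2.const_smul c)).trans (tau_smul q c hy.regular).symm

/-- The maximal operator `A_max`. -/
def maxOp (q : ℝ → ℝ) : L2 →ₗ.[ℂ] L2 := (maxGraph q).toLinearPMap

/-- The graph of `maxOp q` is indeed `maxGraph q`. -/
theorem maxOp_graph (q : ℝ → ℝ) : (maxOp q).graph = maxGraph q := by
  refine Submodule.toLinearPMap_graph_eq _ ?_
  rintro ⟨f, g⟩ ⟨y, hy, hy1, hy2⟩ h0
  simp only at h0 hy1 hy2 ⊢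
  subst h0
  have hy0 : y = 0 := by
    have h1 : y =ᵐ[volume] (0 : ℝ → ℂ) := hy1.symm.trans (Lp.coeFn_zero _ _ _)
    exact (Continuous.ae_eq_iff_eq volume hy.regular.differentiable.continuous
      continuous_const).1 h1
  subst hy0
  rw [tau_zero] at hy2
  exact (Lp.eq_zero_iff_ae_eq_zero).2 hy2

/-- The classes in `L²` having a representative of compact support. -/
def compactlySupported : Submodule ℂ L2 where
  carrier := {f | ∃ y : ℝ → ℂ, HasCompactSupport y ∧ f =ᵐ[volume] y}
  zero_mem' := ⟨0, HasCompactSupport.zero, Lp.coeFn_zero _ _ _⟩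
  add_mem' := by
    rintro f g ⟨y, hy, hfy⟩ ⟨z, hz, hgz⟩
    exact ⟨y + z, hy.add hz, (Lp.coeFn_add _ _).trans (hfy.add hgz)⟩
  smul_mem' := by
    rintro c f ⟨y, hy, hfy⟩
    exact ⟨c • y, hy.smul_left (f := fun _ => c), (Lp.coeFn_smul _ _).trans (hfy.const_smul c)⟩

/-- The pre-minimal operator `A₀`: the maximal operator restricted to the functions of compact
support in its domain. -/
def preMinOp (q : ℝ → ℝ) : L2 →ₗ.[ℂ] L2 := (maxOp q).domRestrict compactlySupported

/-- The minimal operator `A`, the closure of `A₀`. -/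
def minOp (q : ℝ → ℝ) : L2 →ₗ.[ℂ] L2 := (preMinOp q).closure

/-- `T` is an `r`-dimensional bi-extension of `A`: `T` is closed, `A ⊂ T ⊂ A*` and
`dim (dom T / dom A) = r`. -/
structure IsBiExtension (A T : L2 →ₗ.[ℂ] L2) (r : ℕ) : Prop where
  closed : T.IsClosed
  le : A ≤ T
  le_adjoint : T ≤ A†
  rank_eq : Module.rank ℂ (T.domain ⧸ A.domain.submoduleOf T.domain) = r

/-- The parity operator `(P f)(x) = f(-x)` on `L²`. -/
def parity : L2 →ₗᵢ[ℂ] L2 :=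
  Lp.compMeasurePreservingₗᵢ ℂ (fun x : ℝ => -x) (Measure.measurePreserving_neg volume)

/-- `P T P`, with its natural domain `{f | P f ∈ dom T}`. -/
def parityConj (T : L2 →ₗ.[ℂ] L2) : L2 →ₗ.[ℂ] L2 where
  domain := T.domain.comap parity.toLinearMap
  toFun := parity.toLinearMap ∘ₗ T.toFun ∘ₗ
    parity.toLinearMap.restrict (p := T.domain.comap parity.toLinearMap) (q := T.domain)
      (fun _ hx => hx)

/-- The adjoint `T⁺ = P T* P` in the Krein space `L²` with the indefinite inner product
`[f, g] = (f, P g)`, whose fundamental symmetry is `P`. -/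
def kreinAdjoint (T : L2 →ₗ.[ℂ] L2) : L2 →ₗ.[ℂ] L2 := parityConj T†

/-- The expression `[f, g]_x = conj (f x) * g' x - conj (f' x) * g x`. -/
def wr (f g : ℝ → ℂ) (x : ℝ) : ℂ := conj (f x) * deriv g x - conj (deriv f x) * g x

/-- `[w, y]_{-∞}`; see `exists_tendsto_wr_atBot` for the existence of the limit. -/
def bvBot (w y : ℝ → ℂ) : ℂ := limUnder atBot (wr w y)

/-- `[w, y]_{∞}`; see `exists_tendsto_wr_atTop` for the existence of the limit. -/
def bvTop (w y : ℝ → ℂ) : ℂ := limUnder atTop (wr w y)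

/-- A real-valued pair of solutions of `τ_q y = 0` in the maximal domain, `w₁` odd and `w₂` even,
normalized by `[w₁, w₂]_{±∞} = 1`. -/
structure IsBasisPair (q : ℝ → ℝ) (w₁ w₂ : ℝ → ℂ) : Prop where
  max₁ : IsMaxFun q w₁
  max₂ : IsMaxFun q w₂
  sol₁ : IsSolution q 0 w₁
  sol₂ : IsSolution q 0 w₂
  real₁ : ∀ x, conj (w₁ x) = w₁ x
  real₂ : ∀ x, conj (w₂ x) = w₂ x
  odd₁ : ∀ x, w₁ (-x) = - w₁ x
  even₂ : ∀ x, w₂ (-x) = w₂ x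
  wr_bot : Tendsto (wr w₁ w₂) atBot (𝓝 1)
  wr_top : Tendsto (wr w₁ w₂) atTop (𝓝 1)
  wr₁_bot : Tendsto (wr w₁ w₁) atBot (𝓝 0)
  wr₁_top : Tendsto (wr w₁ w₁) atTop (𝓝 0)
  wr₂_bot : Tendsto (wr w₂ w₂) atBot (𝓝 0)
  wr₂_top : Tendsto (wr w₂ w₂) atTop (𝓝 0)

/-- The set of all (classes of) functions `y` in the maximal domain that satisfy `C y`. The
function `y` is unique, being the continuous representative of `f`. -/
def maxDomainWhere (q : ℝ → ℝ) (C : (ℝ → ℂ) → Prop) : Set L2 :=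
  {f | ∃ y : ℝ → ℂ, IsMaxFun q y ∧ f =ᵐ[volume] y ∧ C y}

/-! Existence of the limits of `[f, g]_x` for functions in the maximal domain. -/

theorem LocAC.of_dist_le {X Y : Type*} [PseudoMetricSpace X] [PseudoMetricSpace Y]
    {f : ℝ → X} {g : ℝ → Y} {a b : ℝ} (h : ∀ s t, dist (g s) (g t) ≤ dist (f s) (f t))
    (hf : AbsolutelyContinuousOnInterval f a b) : AbsolutelyContinuousOnInterval g a b :=
  squeeze_zero (fun _ => Finset.sum_nonneg fun _ _ => dist_nonneg)
    (fun _ => Finset.sum_le_sum fun _ _ => h _ _) hf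

theorem LocAC.conj {f : ℝ → ℂ} (hf : LocAC f) : LocAC (fun x => conj (f x)) := fun a b =>
  LocAC.of_dist_le (fun s t => by simp [Complex.dist_conj_conj]) (hf a b)

theorem LocAC.mul {f g : ℝ → ℂ} (hf : LocAC f) (hg : LocAC g) : LocAC (fun x => f x * g x) :=
  fun a b => (hf a b).smul (hg a b)

theorem LocAC.eq_add_integral {f : ℝ → ℂ} (hf : LocAC f) (hi : Integrable (deriv f)) (a b : ℝ) :
    f b = f a + ∫ x in a..b, deriv f x := by
  have key : ∀ (L : ℂ →L[ℝ] ℝ), (∀ z, |L z| ≤ ‖z‖) →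
      L (∫ x in a..b, deriv f x) = L (f b) - L (f a) := by
    intro L hL
    have hac : AbsolutelyContinuousOnInterval (fun x => L (f x)) a b :=
      LocAC.of_dist_le (fun s t => by
        rw [Real.dist_eq, ← map_sub, dist_eq_norm]; exact hL _) (hf a b)
    rw [← hac.integral_deriv_eq_sub, ← L.intervalIntegral_comp_comm hi.intervalIntegrable]
    refine intervalIntegral.integral_congr_ae ?_
    filter_upwards [hf.ae_differentiableAt] with x hx _
    exact ((L.hasFDerivAt.comp_hasDerivAt x hx.hasDerivAt).deriv).symm
  have hre := key Complex.reCLM (fun z => Complex.abs_re_le_norm z)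
  have him := key Complex.imCLM (fun z => Complex.abs_im_le_norm z)
  simp only [Complex.reCLM_apply, Complex.imCLM_apply] at hre him
  apply Complex.ext
  · rw [Complex.add_re, hre]; ring
  · rw [Complex.add_im, him]; ring

theorem wr_locAC {f g : ℝ → ℂ} (hf : IsRegular f) (hg : IsRegular g) : LocAC (wr f g) :=
  fun a b => ((hf.ac.conj.mul hg.ac_deriv) a b).sub ((hf.ac_deriv.conj.mul hg.ac) a b)

theorem integrable_deriv_wr {q : ℝ → ℝ} {f g : ℝ → ℂ} (hf : IsMaxFun q f) (hg : IsMaxFun q g) :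
    Integrable (deriv (wr f g)) := by
  have h1 : Integrable (fun x => conj (tau q f x) * g x) :=
    MemLp.integrable_mul hf.memLp_tau.star hg.memLp
  have h2 : Integrable (fun x => conj (f x) * tau q g x) :=
    MemLp.integrable_mul hf.memLp.star hg.memLp_tau
  refine (h1.sub h2).congr ?_
  filter_upwards [hf.regular.ac_deriv.ae_differentiableAt,
    hg.regular.ac_deriv.ae_differentiableAt] with x hf2 hg2
  have d1 := (hf.regular.differentiable x).hasDerivAt.star.mul hg2.hasDerivAt
  have d2 := hf2.hasDerivAt.star.mul (hg.regular.differentiable x).hasDerivAt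
  have d3 : HasDerivAt (wr f g) _ x := d1.sub d2
  rw [d3.deriv]
  simp only [tau, Pi.sub_apply, map_sub, map_neg, map_mul, Complex.conj_ofReal, Complex.star_def]
  ring

theorem exists_tendsto_wr_atTop {q : ℝ → ℝ} {f g : ℝ → ℂ} (hf : IsMaxFun q f)
    (hg : IsMaxFun q g) : Tendsto (wr f g) atTop (𝓝 (limUnder atTop (wr f g))) := by
  have hi := integrable_deriv_wr hf hg
  have h := (intervalIntegral_tendsto_integral_Ioi 0 hi.integrableOn tendsto_id).const_add
    (wr f g 0)
  refine tendsto_nhds_limUnder ⟨_, h.congr fun x => ?_⟩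
  exact ((wr_locAC hf.regular hg.regular).eq_add_integral hi 0 x).symm

theorem exists_tendsto_wr_atBot {q : ℝ → ℝ} {f g : ℝ → ℂ} (hf : IsMaxFun q f)
    (hg : IsMaxFun q g) : Tendsto (wr f g) atBot (𝓝 (limUnder atBot (wr f g))) := by
  have hi := integrable_deriv_wr hf hg
  have h := (intervalIntegral_tendsto_integral_Iic 0 hi.integrableOn tendsto_id).const_sub
    (wr f g 0)
  refine tendsto_nhds_limUnder ⟨_, h.congr fun x => ?_⟩
  have h2 := (wr_locAC hf.regular hg.regular).eq_add_integral hi x 0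
  rw [h2]
  simp

end

end PTExt

open PTExt

/-!
Send `f` in the maximal domain to its vector of endpoint values
`Γ f = (α₁ f, α₂ f, β₁ f, β₂ f) ∈ ℂ⁴`. Since `w₁`, `w₂` have Wronskian `1`, the Lagrange bracket of
any two functions is `[f, g] = conj [w₁, f] [w₂, g] - conj [w₂, f] [w₁, g]`, so Green's formula
reads `⟪A_max f, g⟫ - ⟪f, A_max g⟫ = ω (Γ f) (Γ g)` with a nondegenerate form `ω` on `ℂ⁴`.
Variation of constants against the square integrable solutions `w₁`, `w₂` solves `τ_q y = v` for
every `v ∈ L²`; it shows that `Γ` is onto, and that the adjoint of the minimal operator is `A_max`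
(if `v` has compact support and is orthogonal to `w₁` and `w₂`, then `y` has compact support).

Consequently, the operators between the minimal and the maximal one are the restrictions of `A_max`
to `Γ⁻¹ V` for subspaces `V` of `ℂ⁴`, and the adjoint corresponds to the `ω`-orthogonal complement
of `V`. Here `V` is the hyperplane `ω u · = 0` with `u` made of the conjugates of `a, b, c, d`, so
its complement is the line through `u`: the domain of the adjoint is `Γ⁻¹ (ℂ u)`. Conjugation by
parity acts on `ℂ⁴` through `(α₁, α₂, β₁, β₂) ↦ (β₁, -β₂, α₁, -α₂)`, which gives the Krein adjoint.
The displayed boundary conditions only spell out membership in a line in terms of whichever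
coordinate of `u` is known to be nonzero.
-/

namespace PTExt

open scoped InnerProductSpace

noncomputable section

section HilbertSpace

variable {𝕜 E : Type*} [RCLike 𝕜] [NormedAddCommGroup E] [InnerProductSpace 𝕜 E]

theorem mem_span_of_orthogonal_of_dense {K : Submodule 𝕜 E} (hK : Dense (K : Set E))
    {ι : Type*} [Finite ι] {w : ι → E} {k : E}
    (h : ∀ g ∈ K, (∀ i, ⟪w i, g⟫_𝕜 = 0) → ⟪k, g⟫_𝕜 = 0) : k ∈ Submodule.span 𝕜 (Set.range w) := by
  cases nonempty_fintype ι
  let L (v : E) : K →ₗ[𝕜] 𝕜 := (innerₛₗ 𝕜 v).domRestrict K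
  have hker : ⨅ i, (L (w i)).ker ≤ (L k).ker := fun g hg =>
    h g g.2 fun i => (Submodule.mem_iInf _).1 hg i
  obtain ⟨c, hc⟩ :=
    (Submodule.mem_span_range_iff_exists_fun 𝕜).1 (mem_span_of_iInf_ker_le_ker hker)
  refine (Submodule.mem_span_range_iff_exists_fun 𝕜).2 ⟨fun i => conj (c i), ?_⟩
  refine hK.eq_of_inner_left 𝕜 fun g hg => ?_
  have hg := LinearMap.congr_fun hc ⟨g, hg⟩
  simpa [L, sum_inner, inner_smul_left] using hg

theorem mem_topologicalClosure_of_adjoint [CompleteSpace E] {g : Submodule 𝕜 (E × E)} {p : E × E}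
    (h : ∀ x ∈ g.adjoint, ⟪p.2, x.1⟫_𝕜 = ⟪p.1, x.2⟫_𝕜) : p ∈ g.topologicalClosure := by
  let e := WithLp.prodContinuousLinearEquiv 2 𝕜 E E
  let K : Submodule 𝕜 (WithLp 2 (E × E)) := g.map (e.symm : E × E →ₗ[𝕜] WithLp 2 (E × E))
  have hp : e.symm p ∈ K.topologicalClosure := by
    rw [← Submodule.orthogonal_orthogonal_eq_closure, Submodule.mem_orthogonal']
    intro x hx
    have hx' : (x.snd, -x.fst) ∈ g.adjoint := by
      rw [Submodule.mem_adjoint_iff]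
      intro a b hab
      have horth := (Submodule.mem_orthogonal _ _).1 hx (e.symm (a, b)) ⟨(a, b), hab, rfl⟩
      rwa [WithLp.prod_inner_apply, add_comm, ← sub_neg_eq_add, ← inner_neg_right] at horth
    have hpx := h _ hx'
    rwa [inner_neg_right, eq_neg_iff_add_eq_zero, add_comm] at hpx
  have hmap : e '' closure (K : Set (WithLp 2 (E × E))) = closure g := by
    rw [e.image_closure]
    simp [K, Set.image_image]
  rw [← SetLike.mem_coe, Submodule.topologicalClosure_coe, ← hmap]
  exact ⟨e.symm p, hp, e.apply_symm_apply p⟩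

theorem adjoint_adjoint_eq_closure [CompleteSpace E] {A : E →ₗ.[𝕜] E}
    (hA : Dense (A.domain : Set E)) (hA' : Dense (A†.domain : Set E)) : A†† = A.closure := by
  have hle : A ≤ A†† := (LinearPMap.adjoint_isFormalAdjoint hA).le_adjoint hA'
  have hclosed : A††.IsClosed := LinearPMap.adjoint_isClosed hA'
  refine LinearPMap.eq_of_eq_graph ?_
  rw [← (hclosed.isClosable.leIsClosable hle).graph_closure_eq_closure_graph]
  refine le_antisymm (fun p hp => mem_topologicalClosure_of_adjoint fun x hx => ?_)
    (A.graph.topologicalClosure_minimal (LinearPMap.le_graph_of_le hle) hclosed)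
  rw [← LinearPMap.adjoint_graph_eq_graph_adjoint hA] at hx
  rw [LinearPMap.adjoint_graph_eq_graph_adjoint hA', Submodule.mem_adjoint_iff] at hp
  have hpx := sub_eq_zero.1 (hp x.1 x.2 hx)
  rw [← inner_conj_symm, ← hpx, inner_conj_symm]

end HilbertSpace

section OrthogonalBilin

variable {𝕜 V : Type*} [Field 𝕜] [StarRing 𝕜] [AddCommGroup V] [Module 𝕜 V]
  {ω : V →ₗ⋆[𝕜] V →ₗ[𝕜] 𝕜}

theorem mem_orthogonalBilin_span_singleton {u v : V} :
    v ∈ (𝕜 ∙ u).orthogonalBilin ω ↔ ω u v = 0 := by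
  refine ⟨fun h => h u (Submodule.mem_span_singleton_self u), fun h n hn => ?_⟩
  obtain ⟨z, rfl⟩ := Submodule.mem_span_singleton.1 hn
  rw [map_smulₛₗ, LinearMap.smul_apply, h, smul_zero]

theorem orthogonalBilin_orthogonalBilin_span_singleton (hrefl : ω.IsRefl)
    (hsep : ω.SeparatingLeft) (u : V) :
    ((𝕜 ∙ u).orthogonalBilin ω).orthogonalBilin ω = 𝕜 ∙ u := by
  refine le_antisymm (fun v hv => ?_) (Submodule.le_orthogonalBilin_orthogonalBilin hrefl)
  have hker : ⨅ _ : Unit, (ω u).ker ≤ (ω v).ker := fun n hn =>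
    hrefl _ _ (hv n (mem_orthogonalBilin_span_singleton.2 ((Submodule.mem_iInf _).1 hn ())))
  have hspan := mem_span_of_iInf_ker_le_ker hker
  rw [Set.range_const, Submodule.mem_span_singleton] at hspan
  obtain ⟨c, hc⟩ := hspan
  refine Submodule.mem_span_singleton.2 ⟨conj c, ?_⟩
  rw [LinearMap.separatingLeft_iff_linear_nontrivial] at hsep
  refine (sub_eq_zero.1 (hsep _ ?_))
  rw [map_sub, map_smulₛₗ, starRingEnd_self_apply, hc, sub_self]

end OrthogonalBilin

section BoundaryRestriction

variable {R E F B : Type*} [Ring R] [AddCommGroup E] [Module R E] [AddCommGroup F] [Module R F]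
  [AddCommGroup B] [Module R B]

theorem le_of_domain_le {S T M : E →ₗ.[R] F} (hS : S ≤ M) (hT : T ≤ M)
    (h : S.domain ≤ T.domain) : S ≤ T :=
  ⟨h, fun x _ hxy =>
    (hS.2 (y := ⟨x, hS.1 x.2⟩) rfl).trans (hT.2 (y := ⟨x, hS.1 x.2⟩) hxy.symm).symm⟩

theorem mem_graph_of_le {T M : E →ₗ.[R] F} (hT : T ≤ M) {f : M.domain}
    (hf : (f : E) ∈ T.domain) : ((f : E), M f) ∈ T.graph := by
  have heq : T ⟨f, hf⟩ = M f := hT.2 rfl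
  exact heq ▸ T.mem_graph ⟨f, hf⟩

/-- The restriction of `M` to the vectors of its domain whose boundary value `Γ f` lies in `V`. -/
def restrictBoundary (M : E →ₗ.[R] F) (Γ : M.domain →ₗ[R] B) (V : Submodule R B) : E →ₗ.[R] F :=
  M.domRestrict ((V.comap Γ).map M.domain.subtype)

variable {M : E →ₗ.[R] F} {Γ : M.domain →ₗ[R] B} {V : Submodule R B}

theorem restrictBoundary_le : restrictBoundary M Γ V ≤ M :=
  LinearPMap.domRestrict_le

theorem mem_restrictBoundary_domain {f : E} :
    f ∈ (restrictBoundary M Γ V).domain ↔ ∃ hf : f ∈ M.domain, Γ ⟨f, hf⟩ ∈ V := by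
  simp only [restrictBoundary, LinearPMap.domRestrict_domain, Submodule.mem_inf, Submodule.mem_map,
    Submodule.mem_comap, Submodule.subtype_apply, Subtype.exists, exists_and_right, exists_eq_right]
  exact ⟨fun h => h.1, fun h => ⟨h, h.1⟩⟩

theorem mem_restrictBoundary_graph {p : E × F} :
    p ∈ (restrictBoundary M Γ V).graph ↔ ∃ f : M.domain, Γ f ∈ V ∧ ((f : E), M f) = p := by
  constructor
  · intro hp
    obtain ⟨hf, hV⟩ := mem_restrictBoundary_domain.1 (LinearPMap.mem_domain_of_mem_graph hp)
    refine ⟨⟨p.1, hf⟩, hV, Prod.ext rfl ?_⟩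
    exact LinearPMap.mem_graph_snd_inj _ (M.mem_graph ⟨p.1, hf⟩)
      (LinearPMap.le_graph_of_le restrictBoundary_le hp) rfl
  · rintro ⟨f, hf, rfl⟩
    exact mem_graph_of_le restrictBoundary_le (mem_restrictBoundary_domain.2 ⟨f.2, hf⟩)

theorem eq_restrictBoundary {T : E →ₗ.[R] F} (hT : T ≤ M)
    (hdom : ∀ f, f ∈ T.domain ↔ ∃ hf : f ∈ M.domain, Γ ⟨f, hf⟩ ∈ V) :
    T = restrictBoundary M Γ V :=
  le_antisymm
    (le_of_domain_le hT restrictBoundary_le fun f hf =>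
      mem_restrictBoundary_domain.2 ((hdom f).1 hf))
    (le_of_domain_le restrictBoundary_le hT fun f hf =>
      (hdom f).2 (mem_restrictBoundary_domain.1 hf))

theorem restrictBoundary_mono {W : Submodule R B} (h : V ≤ W) :
    restrictBoundary M Γ V ≤ restrictBoundary M Γ W :=
  le_of_domain_le restrictBoundary_le restrictBoundary_le fun _ hf =>
    let ⟨hf, hV⟩ := mem_restrictBoundary_domain.1 hf
    mem_restrictBoundary_domain.2 ⟨hf, h hV⟩

theorem restrictBoundary_top : restrictBoundary M Γ ⊤ = M :=
  (eq_restrictBoundary le_rfl fun f => by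
    simp only [Submodule.mem_top, exists_prop, and_true]).symm

variable (M Γ V) in
/-- The boundary values of the vectors in the domain of `restrictBoundary M Γ V`, as elements
of `V`. -/
def boundaryValue : (restrictBoundary M Γ V).domain →ₗ[R] V :=
  (Γ ∘ₗ Submodule.inclusion restrictBoundary_le.1).codRestrict V
    fun f => (mem_restrictBoundary_domain.1 f.2).2

theorem boundaryValue_surjective (hΓ : Function.Surjective Γ) :
    Function.Surjective (boundaryValue M Γ V) := by
  rintro ⟨v, hv⟩
  obtain ⟨f, rfl⟩ := hΓ v
  exact ⟨⟨f, mem_restrictBoundary_domain.2 ⟨f.2, hv⟩⟩, rfl⟩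

theorem ker_boundaryValue : (boundaryValue M Γ V).ker =
    (restrictBoundary M Γ ⊥).domain.submoduleOf (restrictBoundary M Γ V).domain := by
  ext f
  rw [LinearMap.mem_ker, Submodule.submoduleOf, Submodule.mem_comap, mem_restrictBoundary_domain,
    ← ZeroMemClass.coe_eq_zero]
  exact ⟨fun h => ⟨restrictBoundary_le.1 f.2, h⟩, fun ⟨_, h⟩ => h⟩

/-- Modulo the vectors with boundary value zero, the domain of `restrictBoundary M Γ V` is `V`. -/
def restrictBoundaryQuotEquiv (hΓ : Function.Surjective Γ) (V : Submodule R B) :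
    ((restrictBoundary M Γ V).domain ⧸
      (restrictBoundary M Γ ⊥).domain.submoduleOf (restrictBoundary M Γ V).domain) ≃ₗ[R] V :=
  (Submodule.quotEquivOfEq _ _ ker_boundaryValue.symm).trans
    ((boundaryValue M Γ V).quotKerEquivOfSurjective (boundaryValue_surjective hΓ))

end BoundaryRestriction

section BoundaryMap

variable {𝕜 E B : Type*} [RCLike 𝕜] [NormedAddCommGroup E] [InnerProductSpace 𝕜 E]
  [CompleteSpace E] [AddCommGroup B] [Module 𝕜 B]

/-- `Γ` is a boundary map for the symmetric operator `A` with adjoint `M`: it maps the domain of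
`M` onto a space `B` with a nondegenerate sesquilinear form `ω`, the two being linked by Green's
formula. The operators between the closure of `A` and `M` correspond to the subspaces of `B`. -/
structure IsBoundaryMap (A M : E →ₗ.[𝕜] E) (Γ : M.domain →ₗ[𝕜] B) (ω : B →ₗ⋆[𝕜] B →ₗ[𝕜] 𝕜) :
    Prop where
  dense : Dense (A.domain : Set E)
  le : A ≤ M
  adjoint_eq : A† = M
  green : ∀ f g : M.domain, ⟪M f, (g : E)⟫_𝕜 - ⟪(f : E), M g⟫_𝕜 = ω (Γ f) (Γ g)
  surjective : Function.Surjective Γ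
  nondegenerate : ω.Nondegenerate

namespace IsBoundaryMap

variable {A M : E →ₗ.[𝕜] E} {Γ : M.domain →ₗ[𝕜] B} {ω : B →ₗ⋆[𝕜] B →ₗ[𝕜] 𝕜}
  (h : IsBoundaryMap A M Γ ω)
include h

theorem graph_adjoint : A.graph.adjoint = M.graph := by
  rw [← LinearPMap.adjoint_graph_eq_graph_adjoint h.dense, h.adjoint_eq]

theorem map_eq_zero {f : M.domain} (hf : (f : E) ∈ A.domain) : Γ f = 0 := by
  refine h.nondegenerate.1 _ fun v => ?_
  obtain ⟨g, rfl⟩ := h.surjective v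
  have hM : ((g : E), M g) ∈ A.graph.adjoint := h.graph_adjoint ▸ M.mem_graph g
  rw [← h.green]
  exact (Submodule.mem_adjoint_iff _ _).1 hM _ _ (mem_graph_of_le h.le hf)

theorem le_restrictBoundary (V : Submodule 𝕜 B) : A ≤ restrictBoundary M Γ V :=
  le_of_domain_le h.le restrictBoundary_le fun _ hf =>
    mem_restrictBoundary_domain.2
      ⟨h.le.1 hf, (h.map_eq_zero (f := ⟨_, h.le.1 hf⟩) hf).symm ▸ V.zero_mem⟩

theorem dense_restrictBoundary (V : Submodule 𝕜 B) :
    Dense ((restrictBoundary M Γ V).domain : Set E) :=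
  h.dense.mono (h.le_restrictBoundary V).1

theorem adjoint_restrictBoundary (V : Submodule 𝕜 B) :
    (restrictBoundary M Γ V)† = restrictBoundary M Γ (V.orthogonalBilin ω) := by
  refine LinearPMap.eq_of_eq_graph (Submodule.ext fun p => ?_)
  rw [LinearPMap.adjoint_graph_eq_graph_adjoint (h.dense_restrictBoundary V),
    Submodule.mem_adjoint_iff, mem_restrictBoundary_graph]
  constructor
  · intro hp
    have hpM : p ∈ M.graph := by
      rw [← h.graph_adjoint, Submodule.mem_adjoint_iff]
      exact fun a b hab => hp a b (LinearPMap.le_graph_of_le (h.le_restrictBoundary V) hab)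
    obtain ⟨g, rfl⟩ := (LinearPMap.mem_graph_iff' M).1 hpM
    refine ⟨g, fun v hv => ?_, rfl⟩
    obtain ⟨f, rfl⟩ := h.surjective v
    rw [← h.green]
    exact hp _ _ (mem_restrictBoundary_graph.2 ⟨f, hv, rfl⟩)
  · rintro ⟨g, hg, rfl⟩ a b hab
    obtain ⟨f, hf, hfab⟩ := mem_restrictBoundary_graph.1 hab
    obtain ⟨rfl, rfl⟩ := Prod.mk.inj hfab
    rw [h.green]
    exact hg _ hf

theorem closure_eq : A.closure = restrictBoundary M Γ ⊥ := by
  have hdense : Dense (A†.domain : Set E) := by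
    rw [h.adjoint_eq]
    exact h.dense.mono h.le.1
  have hbot : (⊤ : Submodule 𝕜 B).orthogonalBilin ω = ⊥ :=
    (Submodule.eq_bot_iff _).2 fun v hv => h.nondegenerate.2 v fun u => hv u trivial
  rw [← adjoint_adjoint_eq_closure h.dense hdense, h.adjoint_eq, ← hbot,
    ← h.adjoint_restrictBoundary, restrictBoundary_top]

theorem adjoint_closure : A.closure† = M := by
  have htop : (⊥ : Submodule 𝕜 B).orthogonalBilin ω = ⊤ :=
    eq_top_iff.2 fun v _ u hu => by rw [(Submodule.mem_bot 𝕜).1 hu, map_zero, LinearMap.zero_apply]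
  rw [h.closure_eq, h.adjoint_restrictBoundary, htop, restrictBoundary_top]

end IsBoundaryMap

end BoundaryMap

section LocAC

variable {f g : ℝ → ℂ}

theorem LocAC.const (z : ℂ) : LocAC fun _ => z := fun a b => by
  simpa [AbsolutelyContinuousOnInterval] using tendsto_const_nhds

theorem LocAC.add (hf : LocAC f) (hg : LocAC g) : LocAC fun x => f x + g x :=
  fun a b => (hf a b).add (hg a b)

theorem LocAC.sub (hf : LocAC f) (hg : LocAC g) : LocAC fun x => f x - g x :=
  fun a b => (hf a b).sub (hg a b)

theorem LocAC.comp_neg (hf : LocAC f) : LocAC fun x => f (-x) := by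
  intro a b
  rw [absolutelyContinuousOnInterval_iff]
  intro ε hε
  obtain ⟨δ, hδ, h⟩ := (absolutelyContinuousOnInterval_iff _ _ _).1 (hf (-a) (-b)) ε hε
  have neg_mem_uIcc {x : ℝ} (hx : x ∈ Set.uIcc a b) : -x ∈ Set.uIcc (-a) (-b) := by
    rwa [← Set.neg_uIcc, Set.neg_mem_neg]
  refine ⟨δ, hδ, fun E hE hlength => ?_⟩
  refine h (E.1, fun i => (-(E.2 i).1, -(E.2 i).2)) ⟨fun i hi => ?_, fun i hi j hj hij => ?_⟩ ?_
  · exact ⟨neg_mem_uIcc (hE.1 i hi).1, neg_mem_uIcc (hE.1 i hi).2⟩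
  · simpa only [Function.onFun, Set.uIoc, Set.Ioc_disjoint_Ioc, max_neg_neg, min_neg_neg,
      neg_le_neg_iff] using hE.2 hi hj hij
  · simpa only [dist_neg_neg] using hlength

theorem LocAC.continuous (hf : LocAC f) : Continuous f := by
  rw [continuous_iff_continuousAt]
  intro x
  refine (hf (x - 1) (x + 1)).continuousOn.continuousAt ?_
  rw [Set.uIcc_of_le (by linarith)]
  exact Icc_mem_nhds (by linarith) (by linarith)

theorem LocAC.intervalIntegral (hg : LocallyIntegrable g) (c : ℝ) :
    LocAC fun x => ∫ t in c..x, g t := by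
  intro a b
  have hi (s t : ℝ) : IntervalIntegrable g volume s t :=
    (hg.integrableOn_isCompact isCompact_uIcc).intervalIntegrable
  have hac : AbsolutelyContinuousOnInterval (fun x => ∫ t in a..x, ‖g t‖) a b :=
    (hi a b).norm.absolutelyContinuousOnInterval_intervalIntegral Set.left_mem_uIcc
  refine LocAC.of_dist_le (fun s t => ?_) hac
  rw [dist_comm, dist_comm (∫ x in a..s, ‖g x‖), dist_eq_norm, Real.dist_eq,
    intervalIntegral.integral_interval_sub_left (hi c t) (hi c s),
    intervalIntegral.integral_interval_sub_left (hi a t).norm (hi a s).norm]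
  exact intervalIntegral.norm_integral_le_abs_integral_norm

theorem LocAC.eq_of_ae_hasDerivAt_zero (hf : LocAC f) (h : ∀ᵐ x : ℝ, HasDerivAt f 0 x)
    (a b : ℝ) : f a = f b := by
  obtain ⟨C, hC⟩ := (hf a b).const_of_ae_hasDerivAt_zero (h.mono fun x hx _ => hx)
  rw [hC a Set.left_mem_uIcc, hC b Set.right_mem_uIcc]

theorem LocAC.hasDerivAt_of_ae (hf : LocAC f) (hg : Continuous g)
    (h : ∀ᵐ x : ℝ, HasDerivAt f (g x) x) (x : ℝ) : HasDerivAt f (g x) x := by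
  have hprim (x : ℝ) : HasDerivAt (fun x => ∫ t in (0 : ℝ)..x, g t) (g x) x :=
    (hg.integral_hasStrictDerivAt 0 x).hasDerivAt
  have hdiff : LocAC fun x => f x - ∫ t in (0 : ℝ)..x, g t :=
    hf.sub (LocAC.intervalIntegral hg.locallyIntegrable 0)
  have hf_eq : f = fun x => f 0 + ∫ t in (0 : ℝ)..x, g t := by
    funext y
    have hconst := hdiff.eq_of_ae_hasDerivAt_zero
      (h.mono fun x hx => (hx.sub (hprim x)).congr_deriv (sub_self _)) y 0
    rw [intervalIntegral.integral_same, sub_zero] at hconst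
    exact sub_eq_iff_eq_add.1 hconst
  rw [hf_eq]
  exact (hprim x).const_add (f 0)

theorem integral_Iic_eq (hg : Integrable g) :
    (fun x => ∫ t in Set.Iic x, g t) =
      fun x => (∫ t in Set.Iic (0 : ℝ), g t) + ∫ t in (0 : ℝ)..x, g t := by
  funext x
  rw [← intervalIntegral.integral_Iic_sub_Iic hg.integrableOn hg.integrableOn, add_sub_cancel]

theorem LocAC.integral_Iic (hg : Integrable g) : LocAC fun x => ∫ t in Set.Iic x, g t := by
  rw [integral_Iic_eq hg]
  exact (LocAC.const _).add (LocAC.intervalIntegral hg.locallyIntegrable 0)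

theorem ae_hasDerivAt_integral_Iic (hg : Integrable g) :
    ∀ᵐ x : ℝ, HasDerivAt (fun x => ∫ t in Set.Iic x, g t) (g x) x := by
  rw [integral_Iic_eq hg]
  filter_upwards [LocallyIntegrable.ae_hasDerivAt_integral hg.locallyIntegrable] with x hx
  exact (hx 0).const_add _

theorem tendsto_integral_Iic_atBot (hg : Integrable g) :
    Tendsto (fun x => ∫ t in Set.Iic x, g t) atBot (𝓝 0) := by
  rw [integral_Iic_eq hg]
  have h := (intervalIntegral_tendsto_integral_Iic 0 hg.integrableOn tendsto_id).const_sub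
    (∫ t in Set.Iic (0 : ℝ), g t)
  rw [sub_self] at h
  refine h.congr fun x => ?_
  rw [intervalIntegral.integral_symm, id, sub_neg_eq_add]

theorem tendsto_integral_Iic_atTop (hg : Integrable g) :
    Tendsto (fun x => ∫ t in Set.Iic x, g t) atTop (𝓝 (∫ t, g t)) := by
  rw [integral_Iic_eq hg]
  have h := (intervalIntegral_tendsto_integral_Ioi 0 hg.integrableOn tendsto_id).const_add
    (∫ t in Set.Iic (0 : ℝ), g t)
  rwa [intervalIntegral.integral_Iic_add_Ioi hg.integrableOn hg.integrableOn] at h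

theorem norm_integral_Iic_le (hg : Integrable g) (x : ℝ) :
    ‖∫ t in Set.Iic x, g t‖ ≤ ∫ t, ‖g t‖ :=
  (norm_integral_le_integral_norm _).trans
    (setIntegral_le_integral hg.norm (ae_of_all _ fun _ => norm_nonneg _))

theorem integral_Iic_eq_zero {R : ℝ} (hsupp : ∀ t, t ∉ Set.Icc (-R) R → g t = 0)
    (hg : ∫ t, g t = 0) {x : ℝ} (hx : x ∉ Set.Icc (-R) R) : ∫ t in Set.Iic x, g t = 0 := by
  rcases lt_or_ge x (-R) with hlt | hge
  · exact setIntegral_eq_zero_of_forall_eq_zero fun t ht =>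
      hsupp t fun h => (h.1.trans ht).not_gt hlt
  · have hRx : R < x := lt_of_not_ge fun h => hx ⟨hge, h⟩
    rw [setIntegral_eq_integral_of_forall_compl_eq_zero, hg]
    exact fun t ht => hsupp t fun h => ht (h.2.trans hRx.le)

end LocAC

theorem LocAC.integral_deriv {f : ℝ → ℂ} (hf : LocAC f) (hi : Integrable (deriv f)) {m n : ℂ}
    (hbot : Tendsto f atBot (𝓝 m)) (htop : Tendsto f atTop (𝓝 n)) : ∫ x, deriv f x = n - m := by
  refine tendsto_nhds_unique
    (intervalIntegral_tendsto_integral hi tendsto_neg_atTop_atBot tendsto_id)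
    ((htop.sub (hbot.comp tendsto_neg_atTop_atBot)).congr fun x => ?_)
  exact sub_eq_iff_eq_add'.2 (hf.eq_add_integral hi (-x) x)

section Green

variable {q : ℝ → ℝ} {w f g : ℝ → ℂ}

theorem ae_hasDerivAt_wr (q : ℝ → ℝ) (hf : IsRegular f) (hg : IsRegular g) :
    ∀ᵐ x : ℝ, HasDerivAt (wr f g) (conj (tau q f x) * g x - conj (f x) * tau q g x) x := by
  filter_upwards [hf.ac_deriv.ae_differentiableAt, hg.ac_deriv.ae_differentiableAt] with x hf2 hg2
  have hfg' := (hf.differentiable x).hasDerivAt.star.mul hg2.hasDerivAt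
  have hf'g := hf2.hasDerivAt.star.mul (hg.differentiable x).hasDerivAt
  have hwr : HasDerivAt (wr f g) _ x := hfg'.sub hf'g
  refine hwr.congr_deriv ?_
  simp only [tau, map_sub, map_neg, map_mul, Complex.conj_ofReal, Complex.star_def]
  ring

theorem integral_green (hf : IsMaxFun q f) (hg : IsMaxFun q g) :
    (∫ x, conj (tau q f x) * g x) - ∫ x, conj (f x) * tau q g x = bvTop f g - bvBot f g := by
  have htau_f : Integrable fun x => conj (tau q f x) * g x :=
    hf.memLp_tau.star.integrable_mul hg.memLp
  have htau_g : Integrable fun x => conj (f x) * tau q g x :=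
    hf.memLp.star.integrable_mul hg.memLp_tau
  rw [← integral_sub htau_f htau_g]
  calc ∫ x, (conj (tau q f x) * g x - conj (f x) * tau q g x)
      = ∫ x, deriv (wr f g) x :=
        integral_congr_ae
          ((ae_hasDerivAt_wr q hf.regular hg.regular).mono fun x hx => hx.deriv.symm)
    _ = bvTop f g - bvBot f g :=
        (wr_locAC hf.regular hg.regular).integral_deriv (integrable_deriv_wr hf hg)
          (exists_tendsto_wr_atBot hf hg) (exists_tendsto_wr_atTop hf hg)

theorem IsMaxFun.add (hf : IsMaxFun q f) (hg : IsMaxFun q g) : IsMaxFun q (f + g) :=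
  ⟨hf.regular.add hg.regular, hf.memLp.add hg.memLp,
    (memLp_congr_ae (tau_add q hf.regular hg.regular)).2 (hf.memLp_tau.add hg.memLp_tau)⟩

theorem IsMaxFun.smul (c : ℂ) (hf : IsMaxFun q f) : IsMaxFun q (c • f) :=
  ⟨hf.regular.smul c, hf.memLp.const_smul c,
    (memLp_congr_ae (tau_smul q c hf.regular)).2 (hf.memLp_tau.const_smul c)⟩

theorem IsMaxFun.integrable_mul {v : ℝ → ℂ} (hf : IsMaxFun q f) (hv : MemLp v 2 volume) :
    Integrable fun t => f t * v t :=
  hf.memLp.integrable_mul hv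

theorem wr_add_right (w : ℝ → ℂ) (hf : IsRegular f) (hg : IsRegular g) (x : ℝ) :
    wr w (f + g) x = wr w f x + wr w g x := by
  simp only [wr, deriv_add (hf.differentiable x) (hg.differentiable x), Pi.add_apply]
  ring

theorem wr_smul_right (w : ℝ → ℂ) (c : ℂ) (hf : IsRegular f) (x : ℝ) :
    wr w (c • f) x = c * wr w f x := by
  simp only [wr, deriv_const_smul c (hf.differentiable x), Pi.smul_apply, smul_eq_mul]
  ring

theorem bvTop_add (hw : IsMaxFun q w) (hf : IsMaxFun q f) (hg : IsMaxFun q g) :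
    bvTop w (f + g) = bvTop w f + bvTop w g :=
  tendsto_nhds_unique (exists_tendsto_wr_atTop hw (hf.add hg))
    (((exists_tendsto_wr_atTop hw hf).add (exists_tendsto_wr_atTop hw hg)).congr fun x =>
      (wr_add_right w hf.regular hg.regular x).symm)

theorem bvBot_add (hw : IsMaxFun q w) (hf : IsMaxFun q f) (hg : IsMaxFun q g) :
    bvBot w (f + g) = bvBot w f + bvBot w g :=
  tendsto_nhds_unique (exists_tendsto_wr_atBot hw (hf.add hg))
    (((exists_tendsto_wr_atBot hw hf).add (exists_tendsto_wr_atBot hw hg)).congr fun x =>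
      (wr_add_right w hf.regular hg.regular x).symm)

theorem bvTop_smul (hw : IsMaxFun q w) (c : ℂ) (hf : IsMaxFun q f) :
    bvTop w (c • f) = c * bvTop w f :=
  tendsto_nhds_unique (exists_tendsto_wr_atTop hw (hf.smul c))
    (((exists_tendsto_wr_atTop hw hf).const_mul c).congr fun x =>
      (wr_smul_right w c hf.regular x).symm)

theorem bvBot_smul (hw : IsMaxFun q w) (c : ℂ) (hf : IsMaxFun q f) :
    bvBot w (c • f) = c * bvBot w f :=
  tendsto_nhds_unique (exists_tendsto_wr_atBot hw (hf.smul c))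
    (((exists_tendsto_wr_atBot hw hf).const_mul c).congr fun x =>
      (wr_smul_right w c hf.regular x).symm)

theorem wr_eventuallyEq_zero (w : ℝ → ℂ) (hf : HasCompactSupport f) :
    wr w f =ᶠ[cocompact ℝ] fun _ => 0 := by
  filter_upwards [hf.isCompact.compl_mem_cocompact] with x hx
  have hx' : x ∉ tsupport (deriv f) := fun h => hx (tsupport_deriv_subset h)
  rw [wr, image_eq_zero_of_notMem_tsupport hx, image_eq_zero_of_notMem_tsupport hx', mul_zero,
    mul_zero, sub_zero]

theorem bvTop_eq_zero (w : ℝ → ℂ) (hf : HasCompactSupport f) : bvTop w f = 0 :=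
  (tendsto_const_nhds.congr'
    ((wr_eventuallyEq_zero w hf).symm.filter_mono atTop_le_cocompact)).limUnder_eq

theorem bvBot_eq_zero (w : ℝ → ℂ) (hf : HasCompactSupport f) : bvBot w f = 0 :=
  (tendsto_const_nhds.congr'
    ((wr_eventuallyEq_zero w hf).symm.filter_mono atBot_le_cocompact)).limUnder_eq

theorem deriv_comp_neg_eq (f : ℝ → ℂ) : deriv (fun x => f (-x)) = fun x => -deriv f (-x) :=
  funext (deriv_comp_neg f)

theorem tau_comp_neg (hq : ∀ x, q (-x) = q x) (f : ℝ → ℂ) :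
    tau q (fun x => f (-x)) = fun x => tau q f (-x) := by
  funext x
  have hderiv : deriv (fun x => -deriv f (-x)) x = deriv (deriv f) (-x) := by
    rw [deriv.fun_neg, deriv_comp_neg, neg_neg]
  simp only [tau, deriv_comp_neg_eq, hderiv, hq]

theorem IsRegular.comp_neg (hf : IsRegular f) : IsRegular fun x => f (-x) := by
  refine ⟨hf.differentiable.comp differentiable_neg, hf.ac.comp_neg, ?_⟩
  rw [deriv_comp_neg_eq]
  exact fun a b => (hf.ac_deriv.comp_neg a b).neg

theorem IsMaxFun.comp_neg (hq : ∀ x, q (-x) = q x) (hf : IsMaxFun q f) :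
    IsMaxFun q fun x => f (-x) := by
  have hmp := Measure.measurePreserving_neg (volume : Measure ℝ)
  refine ⟨hf.regular.comp_neg, hf.memLp.comp_measurePreserving hmp, ?_⟩
  rw [tau_comp_neg hq]
  exact hf.memLp_tau.comp_measurePreserving hmp

theorem conj_deriv_of_real (hw : ∀ x, conj (w x) = w x) (x : ℝ) : conj (deriv w x) = deriv w x := by
  have hstar := deriv.star (f := w) (x := x)
  rw [show (fun y => star (w y)) = w from funext hw] at hstar
  exact hstar.symm

end Green

section VariationOfConstants

/-- The solution of `τ_q y = v` obtained from the solutions `w₁`, `w₂` of `τ_q y = 0` by variation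
of the constants, with both integrals started at `-∞`. -/
def varConst (w₁ w₂ v : ℝ → ℂ) (x : ℝ) : ℂ :=
  w₁ x * (∫ t in Set.Iic x, w₂ t * v t) - w₂ x * ∫ t in Set.Iic x, w₁ t * v t

/-- The derivative of `varConst w₁ w₂ v`; the terms with `v` cancel. -/
def varConstDeriv (w₁ w₂ v : ℝ → ℂ) (x : ℝ) : ℂ :=
  deriv w₁ x * (∫ t in Set.Iic x, w₂ t * v t) - deriv w₂ x * ∫ t in Set.Iic x, w₁ t * v t

variable {q : ℝ → ℝ} {w₁ w₂ v : ℝ → ℂ}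

theorem hasCompactSupport_varConst (hv : HasCompactSupport v) (h₁ : ∫ t, w₁ t * v t = 0)
    (h₂ : ∫ t, w₂ t * v t = 0) : HasCompactSupport (varConst w₁ w₂ v) := by
  obtain ⟨R, hR⟩ := hv.isCompact.isBounded.subset_closedBall 0
  rw [Real.closedBall_eq_Icc, zero_sub, zero_add] at hR
  have hzero (w : ℝ → ℂ) (t : ℝ) (ht : t ∉ Set.Icc (-R) R) : w t * v t = 0 := by
    rw [image_eq_zero_of_notMem_tsupport fun h => ht (hR h), mul_zero]
  refine HasCompactSupport.intro (isCompact_Icc (a := -R) (b := R)) fun x hx => ?_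
  rw [varConst, integral_Iic_eq_zero (hzero w₁) h₁ hx, integral_Iic_eq_zero (hzero w₂) h₂ hx,
    mul_zero, mul_zero, sub_zero]

theorem hasDerivAt_varConst (hw₁ : IsRegular w₁) (hw₂ : IsRegular w₂)
    (h₁ : Integrable fun t => w₁ t * v t) (h₂ : Integrable fun t => w₂ t * v t) (x : ℝ) :
    HasDerivAt (varConst w₁ w₂ v) (varConstDeriv w₁ w₂ v x) x := by
  have hI₁ := LocAC.integral_Iic h₁
  have hI₂ := LocAC.integral_Iic h₂
  have hcont : Continuous (varConstDeriv w₁ w₂ v) :=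
    (hw₁.ac_deriv.continuous.mul hI₂.continuous).sub (hw₂.ac_deriv.continuous.mul hI₁.continuous)
  refine LocAC.hasDerivAt_of_ae ((hw₁.ac.mul hI₂).sub (hw₂.ac.mul hI₁)) hcont ?_ x
  filter_upwards [ae_hasDerivAt_integral_Iic h₁, ae_hasDerivAt_integral_Iic h₂] with y hy₁ hy₂
  have hderiv : HasDerivAt (varConst w₁ w₂ v) _ y :=
    ((hw₁.differentiable y).hasDerivAt.mul hy₂).sub ((hw₂.differentiable y).hasDerivAt.mul hy₁)
  refine hderiv.congr_deriv ?_
  rw [varConstDeriv]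
  ring

theorem deriv_varConst (hw₁ : IsRegular w₁) (hw₂ : IsRegular w₂)
    (h₁ : Integrable fun t => w₁ t * v t) (h₂ : Integrable fun t => w₂ t * v t) :
    deriv (varConst w₁ w₂ v) = varConstDeriv w₁ w₂ v :=
  funext fun x => (hasDerivAt_varConst hw₁ hw₂ h₁ h₂ x).deriv

theorem isRegular_varConst (hw₁ : IsRegular w₁) (hw₂ : IsRegular w₂)
    (h₁ : Integrable fun t => w₁ t * v t) (h₂ : Integrable fun t => w₂ t * v t) :
    IsRegular (varConst w₁ w₂ v) := by
  have hI₁ := LocAC.integral_Iic h₁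
  have hI₂ := LocAC.integral_Iic h₂
  refine ⟨fun x => (hasDerivAt_varConst hw₁ hw₂ h₁ h₂ x).differentiableAt,
    (hw₁.ac.mul hI₂).sub (hw₂.ac.mul hI₁), ?_⟩
  rw [deriv_varConst hw₁ hw₂ h₁ h₂]
  exact (hw₁.ac_deriv.mul hI₂).sub (hw₂.ac_deriv.mul hI₁)

theorem memLp_mul_integral_Iic {p : ENNReal} {w g : ℝ → ℂ} (hw : MemLp w p volume)
    (hwc : Continuous w) (hg : Integrable g) :
    MemLp (fun x => w x * ∫ t in Set.Iic x, g t) p volume := by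
  refine hw.of_le_mul (c := ∫ t, ‖g t‖)
    (hwc.mul (LocAC.integral_Iic hg).continuous).aestronglyMeasurable (ae_of_all _ fun x => ?_)
  rw [norm_mul, mul_comm]
  exact mul_le_mul_of_nonneg_right (norm_integral_Iic_le hg x) (norm_nonneg _)

theorem memLp_varConst (hw₁ : IsMaxFun q w₁) (hw₂ : IsMaxFun q w₂) (hv : MemLp v 2 volume) :
    MemLp (varConst w₁ w₂ v) 2 volume :=
  (memLp_mul_integral_Iic hw₁.memLp hw₁.regular.ac.continuous (hw₂.integrable_mul hv)).sub
    (memLp_mul_integral_Iic hw₂.memLp hw₂.regular.ac.continuous (hw₁.integrable_mul hv))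

end VariationOfConstants

theorem inner_eq_integral {f g : L2} {y z : ℝ → ℂ} (hf : f =ᵐ[volume] y) (hg : g =ᵐ[volume] z) :
    ⟪f, g⟫_ℂ = ∫ x, conj (y x) * z x := by
  rw [L2.inner_def]
  refine integral_congr_ae ?_
  filter_upwards [hf, hg] with x hfx hgx
  rw [hfx, hgx, RCLike.inner_apply, mul_comm]

theorem integral_conj_mul_self_ne_zero {w : ℝ → ℂ} (hw : MemLp w 2 volume) (hwc : Continuous w)
    (hne : w ≠ 0) : ∫ x, conj (w x) * w x ≠ 0 := by
  rw [← inner_eq_integral hw.coeFn_toLp hw.coeFn_toLp, inner_self_ne_zero]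
  refine fun h => hne ((Continuous.ae_eq_iff_eq volume hwc continuous_zero).1 ?_)
  exact hw.coeFn_toLp.symm.trans (Lp.eq_zero_iff_ae_eq_zero.1 h)

theorem integral_eq_zero_of_odd {f : ℝ → ℂ} (hf : ∀ x, f (-x) = -f x) : ∫ x, f x = 0 := by
  have h := integral_neg_eq_self f volume
  rw [funext hf, integral_neg] at h
  exact self_eq_neg.1 h.symm

/-- The endpoint values `(α₁ f, α₂ f, β₁ f, β₂ f)`. -/
def endpointValues (w₁ w₂ f : ℝ → ℂ) : Fin 4 → ℂ :=
  ![bvBot w₁ f, bvBot w₂ f, bvTop w₁ f, bvTop w₂ f]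

/-- The form through which Green's formula depends on the endpoint values, `[f, g]_∞ - [f, g]_{-∞}`
written in terms of `endpointValues w₁ w₂ f` and `endpointValues w₁ w₂ g`. -/
def endpointForm : (Fin 4 → ℂ) →ₗ⋆[ℂ] (Fin 4 → ℂ) →ₗ[ℂ] ℂ :=
  LinearMap.mk₂'ₛₗ (starRingEnd ℂ) (RingHom.id ℂ)
    (fun u v => conj (u 2) * v 3 - conj (u 3) * v 2 - (conj (u 0) * v 1 - conj (u 1) * v 0))
    (fun u u' v => by simp only [Pi.add_apply, map_add]; ring)
    (fun z u v => by simp only [Pi.smul_apply, smul_eq_mul, map_mul]; ring)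
    (fun u v v' => by simp only [Pi.add_apply]; ring)
    (fun z u v => by simp only [Pi.smul_apply, smul_eq_mul, RingHom.id_apply]; ring)

theorem endpointForm_apply (u v : Fin 4 → ℂ) : endpointForm u v =
    conj (u 2) * v 3 - conj (u 3) * v 2 - (conj (u 0) * v 1 - conj (u 1) * v 0) :=
  rfl

theorem neg_conj_endpointForm (u v : Fin 4 → ℂ) :
    -conj (endpointForm u v) = endpointForm v u := by
  simp only [endpointForm_apply, map_sub, map_mul, starRingEnd_self_apply]
  ring

theorem isRefl_endpointForm : endpointForm.IsRefl := fun u v h => by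
  rw [← neg_conj_endpointForm, h, map_zero, neg_zero]

theorem nondegenerate_endpointForm : endpointForm.Nondegenerate := by
  have hright : endpointForm.SeparatingRight := fun v hv => by
    have h₀ : v 0 = 0 := by simpa [endpointForm_apply] using hv (Pi.single 1 1)
    have h₁ : v 1 = 0 := by simpa [endpointForm_apply] using hv (Pi.single 0 1)
    have h₂ : v 2 = 0 := by simpa [endpointForm_apply] using hv (Pi.single 3 1)
    have h₃ : v 3 = 0 := by simpa [endpointForm_apply] using hv (Pi.single 2 1)
    ext i
    fin_cases i <;> assumption
  exact ⟨fun u hu => hright u fun v => isRefl_endpointForm _ _ (hu v), hright⟩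

namespace IsBasisPair

variable {q : ℝ → ℝ} {w₁ w₂ : ℝ → ℂ} (hw : IsBasisPair q w₁ w₂)
include hw

theorem wr_eq_one (x : ℝ) : wr w₁ w₂ x = 1 := by
  have hderiv : ∀ᵐ y : ℝ, HasDerivAt (wr w₁ w₂) 0 y := by
    filter_upwards [ae_hasDerivAt_wr q hw.max₁.regular hw.max₂.regular, hw.sol₁.eq, hw.sol₂.eq]
      with y hwr h₁ h₂
    simpa only [h₁, h₂, zero_mul, map_zero, mul_zero, sub_zero] using hwr
  have hconst (y : ℝ) : wr w₁ w₂ x = wr w₁ w₂ y :=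
    (wr_locAC hw.max₁.regular hw.max₂.regular).eq_of_ae_hasDerivAt_zero hderiv x y
  exact tendsto_nhds_unique (tendsto_const_nhds.congr hconst) hw.wr_top

theorem wr₁_apply (f : ℝ → ℂ) (x : ℝ) : wr w₁ f x = w₁ x * deriv f x - deriv w₁ x * f x := by
  rw [wr, conj_deriv_of_real hw.real₁, hw.real₁]

theorem wr₂_apply (f : ℝ → ℂ) (x : ℝ) : wr w₂ f x = w₂ x * deriv f x - deriv w₂ x * f x := by
  rw [wr, conj_deriv_of_real hw.real₂, hw.real₂]

theorem wronskian (x : ℝ) : w₁ x * deriv w₂ x - deriv w₁ x * w₂ x = 1 := by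
  rw [← hw.wr₁_apply, hw.wr_eq_one]

theorem wr_eq (f g : ℝ → ℂ) (x : ℝ) :
    wr f g x = conj (wr w₁ f x) * wr w₂ g x - conj (wr w₂ f x) * wr w₁ g x := by
  rw [hw.wr₁_apply, hw.wr₁_apply, hw.wr₂_apply, hw.wr₂_apply]
  simp only [map_sub, map_mul, hw.real₁, hw.real₂, conj_deriv_of_real hw.real₁,
    conj_deriv_of_real hw.real₂, wr]
  linear_combination -(conj (f x) * deriv g x - conj (deriv f x) * g x) * hw.wronskian x

theorem bvTop_eq {f g : ℝ → ℂ} (hf : IsMaxFun q f) (hg : IsMaxFun q g) :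
    bvTop f g = conj (bvTop w₁ f) * bvTop w₂ g - conj (bvTop w₂ f) * bvTop w₁ g := by
  refine tendsto_nhds_unique (exists_tendsto_wr_atTop hf hg) ?_
  rw [funext (hw.wr_eq f g)]
  exact ((exists_tendsto_wr_atTop hw.max₁ hf).star.mul (exists_tendsto_wr_atTop hw.max₂ hg)).sub
    ((exists_tendsto_wr_atTop hw.max₂ hf).star.mul (exists_tendsto_wr_atTop hw.max₁ hg))

theorem bvBot_eq {f g : ℝ → ℂ} (hf : IsMaxFun q f) (hg : IsMaxFun q g) :
    bvBot f g = conj (bvBot w₁ f) * bvBot w₂ g - conj (bvBot w₂ f) * bvBot w₁ g := by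
  refine tendsto_nhds_unique (exists_tendsto_wr_atBot hf hg) ?_
  rw [funext (hw.wr_eq f g)]
  exact ((exists_tendsto_wr_atBot hw.max₁ hf).star.mul (exists_tendsto_wr_atBot hw.max₂ hg)).sub
    ((exists_tendsto_wr_atBot hw.max₂ hf).star.mul (exists_tendsto_wr_atBot hw.max₁ hg))

theorem bvTop_sub_bvBot {f g : ℝ → ℂ} (hf : IsMaxFun q f) (hg : IsMaxFun q g) :
    bvTop f g - bvBot f g =
      endpointForm (endpointValues w₁ w₂ f) (endpointValues w₁ w₂ g) := by
  rw [hw.bvTop_eq hf hg, hw.bvBot_eq hf hg]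
  rfl

theorem endpointValues_add {f g : ℝ → ℂ} (hf : IsMaxFun q f) (hg : IsMaxFun q g) :
    endpointValues w₁ w₂ (f + g) = endpointValues w₁ w₂ f + endpointValues w₁ w₂ g := by
  simp only [endpointValues, bvBot_add hw.max₁ hf hg, bvBot_add hw.max₂ hf hg,
    bvTop_add hw.max₁ hf hg, bvTop_add hw.max₂ hf hg, Matrix.add_cons, Matrix.head_cons,
    Matrix.tail_cons, Matrix.empty_add_empty]

theorem endpointValues_smul (c : ℂ) {f : ℝ → ℂ} (hf : IsMaxFun q f) :
    endpointValues w₁ w₂ (c • f) = c • endpointValues w₁ w₂ f := by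
  simp only [endpointValues, bvBot_smul hw.max₁ c hf, bvBot_smul hw.max₂ c hf,
    bvTop_smul hw.max₁ c hf, bvTop_smul hw.max₂ c hf, Matrix.smul_cons, smul_eq_mul,
    Matrix.smul_empty]

theorem endpointValues₁ : endpointValues w₁ w₂ w₁ = ![0, -1, 0, -1] := by
  have hwr : wr w₂ w₁ = fun _ => -1 := funext fun x => by
    rw [hw.wr₂_apply]
    linear_combination -hw.wronskian x
  rw [endpointValues, bvBot, bvBot, bvTop, bvTop, hw.wr₁_bot.limUnder_eq, hw.wr₁_top.limUnder_eq,
    hwr, tendsto_const_nhds.limUnder_eq, tendsto_const_nhds.limUnder_eq]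

theorem endpointValues₂ : endpointValues w₁ w₂ w₂ = ![1, 0, 1, 0] := by
  rw [endpointValues, bvBot, bvBot, bvTop, bvTop, hw.wr_bot.limUnder_eq, hw.wr_top.limUnder_eq,
    hw.wr₂_bot.limUnder_eq, hw.wr₂_top.limUnder_eq]

theorem endpointValues_comp_neg {f : ℝ → ℂ} (hf : IsMaxFun q f) :
    endpointValues w₁ w₂ (fun x => f (-x)) =
      ![bvTop w₁ f, -bvTop w₂ f, bvBot w₁ f, -bvBot w₂ f] := by
  have hderiv₁ (x : ℝ) : deriv w₁ (-x) = deriv w₁ x := by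
    have h := congrFun (deriv_comp_neg_eq w₁) x
    rw [funext hw.odd₁, deriv.fun_neg] at h
    exact (neg_injective h).symm
  have hderiv₂ (x : ℝ) : deriv w₂ (-x) = -deriv w₂ x := by
    have h := congrFun (deriv_comp_neg_eq w₂) x
    rw [funext hw.even₂] at h
    rw [h, neg_neg]
  have hwr₁ : wr w₁ (fun x => f (-x)) = fun x => wr w₁ f (-x) := funext fun x => by
    rw [hw.wr₁_apply, hw.wr₁_apply, deriv_comp_neg_eq, hderiv₁, hw.odd₁]
    ring
  have hwr₂ : wr w₂ (fun x => f (-x)) = fun x => -wr w₂ f (-x) := funext fun x => by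
    rw [hw.wr₂_apply, hw.wr₂_apply, deriv_comp_neg_eq, hderiv₂, hw.even₂]
    ring
  have hbot {w} (h : IsMaxFun q w) : Tendsto (fun x => wr w f (-x)) atBot (𝓝 (bvTop w f)) :=
    (exists_tendsto_wr_atTop h hf).comp tendsto_neg_atBot_atTop
  have htop {w} (h : IsMaxFun q w) : Tendsto (fun x => wr w f (-x)) atTop (𝓝 (bvBot w f)) :=
    (exists_tendsto_wr_atBot h hf).comp tendsto_neg_atTop_atBot
  rw [endpointValues, bvBot, bvBot, bvTop, bvTop, hwr₁, hwr₂, (hbot hw.max₁).limUnder_eq,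
    (hbot hw.max₂).neg.limUnder_eq, (htop hw.max₁).limUnder_eq, (htop hw.max₂).neg.limUnder_eq]

section VarConst

variable {v : ℝ → ℂ} (hv : MemLp v 2 volume)
include hv

theorem deriv_varConst : deriv (varConst w₁ w₂ v) = varConstDeriv w₁ w₂ v :=
  PTExt.deriv_varConst hw.max₁.regular hw.max₂.regular (hw.max₁.integrable_mul hv)
    (hw.max₂.integrable_mul hv)

theorem tau_varConst : tau q (varConst w₁ w₂ v) =ᵐ[volume] v := by
  filter_upwards [ae_hasDerivAt_integral_Iic (hw.max₁.integrable_mul hv),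
    ae_hasDerivAt_integral_Iic (hw.max₂.integrable_mul hv),
    hw.max₁.regular.ac_deriv.ae_differentiableAt, hw.max₂.regular.ac_deriv.ae_differentiableAt,
    hw.sol₁.eq, hw.sol₂.eq] with x hI₁ hI₂ hd₁ hd₂ hsol₁ hsol₂
  have hderiv : HasDerivAt (varConstDeriv w₁ w₂ v) _ x :=
    (hd₁.hasDerivAt.mul hI₂).sub (hd₂.hasDerivAt.mul hI₁)
  simp only [tau, zero_mul] at hsol₁ hsol₂
  rw [tau, hw.deriv_varConst hv, hderiv.deriv, varConst]
  linear_combination (∫ t in Set.Iic x, w₂ t * v t) * hsol₁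
    - (∫ t in Set.Iic x, w₁ t * v t) * hsol₂ + v x * hw.wronskian x

theorem isMaxFun_varConst : IsMaxFun q (varConst w₁ w₂ v) :=
  ⟨isRegular_varConst hw.max₁.regular hw.max₂.regular (hw.max₁.integrable_mul hv)
    (hw.max₂.integrable_mul hv), memLp_varConst hw.max₁ hw.max₂ hv,
    (memLp_congr_ae (hw.tau_varConst hv)).2 hv⟩

theorem wr₁_varConst :
    wr w₁ (varConst w₁ w₂ v) = fun x => -∫ t in Set.Iic x, w₁ t * v t := by
  funext x
  rw [hw.wr₁_apply, hw.deriv_varConst hv, varConst, varConstDeriv]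
  linear_combination (-∫ t in Set.Iic x, w₁ t * v t) * hw.wronskian x

theorem wr₂_varConst :
    wr w₂ (varConst w₁ w₂ v) = fun x => -∫ t in Set.Iic x, w₂ t * v t := by
  funext x
  rw [hw.wr₂_apply, hw.deriv_varConst hv, varConst, varConstDeriv]
  linear_combination (-∫ t in Set.Iic x, w₂ t * v t) * hw.wronskian x

theorem endpointValues_varConst : endpointValues w₁ w₂ (varConst w₁ w₂ v) =
    ![0, 0, -∫ t, w₁ t * v t, -∫ t, w₂ t * v t] := by
  have h₁ := hw.max₁.integrable_mul hv
  have h₂ := hw.max₂.integrable_mul hv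
  rw [endpointValues, bvBot, bvBot, bvTop, bvTop, hw.wr₁_varConst hv, hw.wr₂_varConst hv,
    (tendsto_integral_Iic_atBot h₁).neg.limUnder_eq,
    (tendsto_integral_Iic_atBot h₂).neg.limUnder_eq,
    (tendsto_integral_Iic_atTop h₁).neg.limUnder_eq,
    (tendsto_integral_Iic_atTop h₂).neg.limUnder_eq, neg_zero]

end VarConst

theorem ne_zero₁ : w₁ ≠ 0 := by
  rintro rfl
  simpa [wr] using hw.wr_eq_one 0

theorem ne_zero₂ : w₂ ≠ 0 := by
  rintro rfl
  simpa [wr] using hw.wr_eq_one 0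

theorem exists_integral_mul_eq (m₁ m₂ : ℂ) : ∃ v : ℝ → ℂ, MemLp v 2 volume ∧
    ∫ t, w₁ t * v t = m₁ ∧ ∫ t, w₂ t * v t = m₂ := by
  have hn₁ : ∫ t, w₁ t * w₁ t ≠ 0 := by
    simpa only [hw.real₁] using
      integral_conj_mul_self_ne_zero hw.max₁.memLp hw.max₁.regular.ac.continuous hw.ne_zero₁
  have hn₂ : ∫ t, w₂ t * w₂ t ≠ 0 := by
    simpa only [hw.real₂] using
      integral_conj_mul_self_ne_zero hw.max₂.memLp hw.max₂.regular.ac.continuous hw.ne_zero₂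
  have h₁₂ : ∫ t, w₁ t * w₂ t = 0 :=
    integral_eq_zero_of_odd fun t => by rw [hw.odd₁, hw.even₂, neg_mul]
  have h₂₁ : ∫ t, w₂ t * w₁ t = 0 := by simpa only [mul_comm] using h₁₂
  have hint (w : ℝ → ℂ) (hmax : IsMaxFun q w) (z₁ z₂ : ℂ) :
      ∫ t, w t * (z₁ * w₁ t + z₂ * w₂ t) =
        z₁ * (∫ t, w t * w₁ t) + z₂ * ∫ t, w t * w₂ t := by
    simp only [mul_add, mul_left_comm (w _)]
    rw [integral_add ((hmax.integrable_mul hw.max₁.memLp).const_mul z₁)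
      ((hmax.integrable_mul hw.max₂.memLp).const_mul z₂), integral_const_mul,
      integral_const_mul]
  refine ⟨fun t => m₁ / (∫ t, w₁ t * w₁ t) * w₁ t + m₂ / (∫ t, w₂ t * w₂ t) * w₂ t,
    (hw.max₁.memLp.const_mul _).add (hw.max₂.memLp.const_mul _), ?_, ?_⟩
  · rw [hint w₁ hw.max₁, h₁₂, mul_zero, add_zero, div_mul_cancel₀ _ hn₁]
  · rw [hint w₂ hw.max₂, h₂₁, mul_zero, zero_add, div_mul_cancel₀ _ hn₂]

theorem exists_endpointValues_eq (x : Fin 4 → ℂ) :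
    ∃ f, IsMaxFun q f ∧ endpointValues w₁ w₂ f = x := by
  obtain ⟨v, hv, hv₁, hv₂⟩ := hw.exists_integral_mul_eq (x 0 - x 2) (x 1 - x 3)
  have hvar := hw.isMaxFun_varConst hv
  have hlin := (hw.max₁.smul (-x 1)).add (hw.max₂.smul (x 0))
  refine ⟨_, hvar.add hlin, ?_⟩
  rw [hw.endpointValues_add hvar hlin,
    hw.endpointValues_add (hw.max₁.smul (-x 1)) (hw.max₂.smul (x 0)),
    hw.endpointValues_smul _ hw.max₁, hw.endpointValues_smul _ hw.max₂,
    hw.endpointValues_varConst hv, hv₁, hv₂, hw.endpointValues₁, hw.endpointValues₂]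
  ext i
  fin_cases i <;> simp

end IsBasisPair

theorem dense_compactlySupported : Dense (compactlySupported : Set L2) := by
  refine Metric.dense_iff.2 fun f ε hε => ?_
  obtain ⟨g, hgs, hfg, -, hg⟩ := (Lp.memLp f).exists_hasCompactSupport_eLpNorm_sub_le
    ENNReal.ofNat_ne_top (ENNReal.ofReal_pos.2 (half_pos hε)).ne'
  refine ⟨hg.toLp g, ?_, g, hgs, hg.coeFn_toLp⟩
  rw [Metric.mem_ball, dist_comm, Lp.dist_def]
  have hcongr : ⇑f - ⇑(hg.toLp g) =ᵐ[volume] ⇑f - g := (ae_eq_refl _).sub hg.coeFn_toLp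
  rw [eLpNorm_congr_ae hcongr]
  exact (ENNReal.toReal_le_of_le_ofReal (half_pos hε).le hfg).trans_lt (half_lt_self hε)

theorem hasCompactSupport_of_ae_eq {y z : ℝ → ℂ} (hy : Continuous y) (hz : HasCompactSupport z)
    (h : y =ᵐ[volume] z) : HasCompactSupport y := by
  refine HasCompactSupport.intro hz.isCompact fun x hx => ?_
  have hopen : IsOpen (tsupport z)ᶜ := (isClosed_tsupport z).isOpen_compl
  refine Measure.eqOn_open_of_ae_eq (μ := volume) (f := y) (g := fun _ => 0) ?_ hopen
    hy.continuousOn continuousOn_const hx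
  rw [EventuallyEq, ae_restrict_iff' hopen.measurableSet]
  filter_upwards [h] with t ht ht'
  rw [ht, image_eq_zero_of_notMem_tsupport ht']

section MaximalOperator

variable {q : ℝ → ℝ}

theorem exists_isMaxFun (f : (maxOp q).domain) :
    ∃ y, IsMaxFun q y ∧ f =ᵐ[volume] y ∧ maxOp q f =ᵐ[volume] tau q y := by
  have h := (maxOp q).mem_graph f
  rwa [maxOp_graph] at h

/-- The continuous representative of an element of the domain of the maximal operator. -/
def continuousRep (f : (maxOp q).domain) : ℝ → ℂ :=
  (exists_isMaxFun f).choose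

theorem isMaxFun_continuousRep (f : (maxOp q).domain) : IsMaxFun q (continuousRep f) :=
  (exists_isMaxFun f).choose_spec.1

theorem ae_eq_continuousRep (f : (maxOp q).domain) : f =ᵐ[volume] continuousRep f :=
  (exists_isMaxFun f).choose_spec.2.1

theorem maxOp_ae_eq_tau (f : (maxOp q).domain) :
    maxOp q f =ᵐ[volume] tau q (continuousRep f) :=
  (exists_isMaxFun f).choose_spec.2.2

theorem continuousRep_eq {f : (maxOp q).domain} {y : ℝ → ℂ} (hy : IsMaxFun q y)
    (hf : f =ᵐ[volume] y) : continuousRep f = y :=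
  (Continuous.ae_eq_iff_eq volume (isMaxFun_continuousRep f).regular.ac.continuous
    hy.regular.ac.continuous).1 ((ae_eq_continuousRep f).symm.trans hf)

theorem continuousRep_add (f g : (maxOp q).domain) :
    continuousRep (f + g) = continuousRep f + continuousRep g :=
  continuousRep_eq ((isMaxFun_continuousRep f).add (isMaxFun_continuousRep g))
    ((Lp.coeFn_add _ _).trans ((ae_eq_continuousRep f).add (ae_eq_continuousRep g)))

theorem continuousRep_smul (c : ℂ) (f : (maxOp q).domain) :
    continuousRep (c • f) = c • continuousRep f :=
  continuousRep_eq ((isMaxFun_continuousRep f).smul c)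
    ((Lp.coeFn_smul _ _).trans ((ae_eq_continuousRep f).const_smul c))

theorem mem_maxOp_domain {f : L2} {y : ℝ → ℂ} (hy : IsMaxFun q y) (hf : f =ᵐ[volume] y) :
    f ∈ (maxOp q).domain := by
  have h : (f, hy.memLp_tau.toLp (tau q y)) ∈ maxGraph q :=
    ⟨y, hy, hf, hy.memLp_tau.coeFn_toLp⟩
  rw [← maxOp_graph] at h
  exact LinearPMap.mem_domain_of_mem_graph h

theorem mem_maxDomainWhere {C : (ℝ → ℂ) → Prop} {f : L2} :
    f ∈ maxDomainWhere q C ↔ ∃ hf : f ∈ (maxOp q).domain, C (continuousRep ⟨f, hf⟩) := by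
  constructor
  · rintro ⟨y, hy, hfy, hC⟩
    exact ⟨mem_maxOp_domain hy hfy, (continuousRep_eq (f := ⟨f, _⟩) hy hfy).symm ▸ hC⟩
  · rintro ⟨hf, hC⟩
    exact ⟨_, isMaxFun_continuousRep _, ae_eq_continuousRep ⟨f, hf⟩, hC⟩

/-- A function of the maximal domain as an element of the domain of the maximal operator. -/
def IsMaxFun.toDomain {y : ℝ → ℂ} (hy : IsMaxFun q y) : (maxOp q).domain :=
  ⟨hy.memLp.toLp y, mem_maxOp_domain hy hy.memLp.coeFn_toLp⟩

theorem coeFn_toDomain {y : ℝ → ℂ} (hy : IsMaxFun q y) : hy.toDomain =ᵐ[volume] y :=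
  hy.memLp.coeFn_toLp

theorem continuousRep_toDomain {y : ℝ → ℂ} (hy : IsMaxFun q y) :
    continuousRep hy.toDomain = y :=
  continuousRep_eq hy (coeFn_toDomain hy)

theorem maxOp_toDomain {y : ℝ → ℂ} (hy : IsMaxFun q y) {g : L2} (h : tau q y =ᵐ[volume] g) :
    maxOp q hy.toDomain = g := by
  refine Lp.ext ((maxOp_ae_eq_tau _).trans ?_)
  rwa [continuousRep_toDomain]

theorem inner_maxOp_sub_inner_maxOp (f g : (maxOp q).domain) :
    ⟪maxOp q f, (g : L2)⟫_ℂ - ⟪(f : L2), maxOp q g⟫_ℂ =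
      bvTop (continuousRep f) (continuousRep g) - bvBot (continuousRep f) (continuousRep g) := by
  rw [inner_eq_integral (maxOp_ae_eq_tau f) (ae_eq_continuousRep g),
    inner_eq_integral (ae_eq_continuousRep f) (maxOp_ae_eq_tau g),
    integral_green (isMaxFun_continuousRep f) (isMaxFun_continuousRep g)]

theorem preMinOp_le_maxOp : preMinOp q ≤ maxOp q :=
  LinearPMap.domRestrict_le

theorem mem_preMinOp_domain {f : (maxOp q).domain} :
    (f : L2) ∈ (preMinOp q).domain ↔ HasCompactSupport (continuousRep f) := by
  rw [preMinOp, LinearPMap.domRestrict_domain, Submodule.mem_inf, and_iff_left f.2]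
  constructor
  · rintro ⟨y, hy, hfy⟩
    exact hasCompactSupport_of_ae_eq (isMaxFun_continuousRep f).regular.ac.continuous hy
      ((ae_eq_continuousRep f).symm.trans hfy)
  · exact fun h => ⟨_, h, ae_eq_continuousRep f⟩

theorem inner_maxOp_of_mem_preMinOp_domain {f g : (maxOp q).domain}
    (hg : (g : L2) ∈ (preMinOp q).domain) :
    ⟪maxOp q f, (g : L2)⟫_ℂ = ⟪(f : L2), maxOp q g⟫_ℂ := by
  have hsupp := mem_preMinOp_domain.1 hg
  rw [← sub_eq_zero, inner_maxOp_sub_inner_maxOp, bvTop_eq_zero _ hsupp, bvBot_eq_zero _ hsupp,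
    sub_zero]

end MaximalOperator

namespace IsBasisPair

variable {q : ℝ → ℝ} {w₁ w₂ : ℝ → ℂ} (hw : IsBasisPair q w₁ w₂)

/-- The solutions `w₁` and `w₂` as elements of the domain of the maximal operator. -/
def solution : Fin 2 → (maxOp q).domain :=
  ![hw.max₁.toDomain, hw.max₂.toDomain]

include hw

theorem maxOp_solution (i : Fin 2) : maxOp q (hw.solution i) = 0 := by
  have hzero {w : ℝ → ℂ} (hsol : IsSolution q 0 w) : tau q w =ᵐ[volume] (0 : L2) := by
    filter_upwards [hsol.eq, Lp.coeFn_zero ℂ 2 (volume : Measure ℝ)] with x hx hx₀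
    rw [hx, hx₀, zero_mul, Pi.zero_apply]
  fin_cases i
  exacts [maxOp_toDomain hw.max₁ (hzero hw.sol₁), maxOp_toDomain hw.max₂ (hzero hw.sol₂)]

theorem exists_maxOp_eq (g : L2) : ∃ f : (maxOp q).domain, maxOp q f = g :=
  ⟨(hw.isMaxFun_varConst (Lp.memLp g)).toDomain,
    maxOp_toDomain _ (hw.tau_varConst (Lp.memLp g))⟩

theorem exists_mem_preMinOp_domain_maxOp_eq {g : L2} (hg : g ∈ compactlySupported)
    (h : ∀ i, ⟪(hw.solution i : L2), g⟫_ℂ = 0) :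
    ∃ f : (maxOp q).domain, (f : L2) ∈ (preMinOp q).domain ∧ maxOp q f = g := by
  obtain ⟨v, hvs, hgv⟩ := hg
  have hv : MemLp v 2 volume := (memLp_congr_ae hgv).1 (Lp.memLp g)
  have hint {w : ℝ → ℂ} (hmax : IsMaxFun q w) (hreal : ∀ x, conj (w x) = w x)
      (horth : ⟪(hmax.toDomain : L2), g⟫_ℂ = 0) : ∫ t, w t * v t = 0 := by
    rw [← horth, inner_eq_integral (coeFn_toDomain hmax) hgv]
    simp only [hreal]
  have hvar := hw.isMaxFun_varConst hv
  refine ⟨hvar.toDomain, mem_preMinOp_domain.2 ?_,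
    maxOp_toDomain hvar ((hw.tau_varConst hv).trans hgv.symm)⟩
  rw [continuousRep_toDomain]
  exact hasCompactSupport_varConst hvs (hint hw.max₁ hw.real₁ (h 0)) (hint hw.max₂ hw.real₂ (h 1))

theorem adjoint_graph_preMinOp : (preMinOp q).graph.adjoint = (maxOp q).graph := by
  ext ⟨u, v⟩
  rw [Submodule.mem_adjoint_iff]
  constructor
  · intro h
    obtain ⟨z, rfl⟩ := hw.exists_maxOp_eq v
    have hspan : u - z ∈ Submodule.span ℂ (Set.range fun i => (hw.solution i : L2)) := by
      refine mem_span_of_orthogonal_of_dense dense_compactlySupported fun g hg horth => ?_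
      obtain ⟨f, hf, rfl⟩ := hw.exists_mem_preMinOp_domain_maxOp_eq hg horth
      have hu := sub_eq_zero.1 (h _ _ (mem_graph_of_le preMinOp_le_maxOp hf))
      rw [inner_sub_left, ← inner_maxOp_of_mem_preMinOp_domain hf, ← inner_conj_symm, hu,
        inner_conj_symm, sub_self]
    have hker : (u - z, 0) ∈ (maxOp q).graph := by
      refine (Submodule.span_le (p := (maxOp q).graph.comap (LinearMap.inl ℂ L2 L2))).2 ?_ hspan
      rintro _ ⟨i, rfl⟩
      have hgraph := (maxOp q).mem_graph (hw.solution i)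
      rwa [hw.maxOp_solution i] at hgraph
    simpa using add_mem hker ((maxOp q).mem_graph z)
  · intro h f f' hf
    obtain ⟨z, hz⟩ := (LinearPMap.mem_graph_iff' _).1 h
    obtain ⟨g, hg⟩ := (LinearPMap.mem_graph_iff' _).1
      (LinearPMap.le_graph_of_le preMinOp_le_maxOp hf)
    obtain ⟨rfl, rfl⟩ := Prod.mk.inj hz
    obtain ⟨rfl, rfl⟩ := Prod.mk.inj hg
    have hmem := LinearPMap.mem_domain_of_mem_graph hf
    rw [sub_eq_zero, ← inner_conj_symm, ← inner_maxOp_of_mem_preMinOp_domain hmem,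
      inner_conj_symm]

theorem dense_preMinOp_domain : Dense ((preMinOp q).domain : Set L2) := by
  rw [Submodule.dense_iff_topologicalClosure_eq_top, Submodule.topologicalClosure_eq_top_iff,
    Submodule.eq_bot_iff]
  intro k hk
  have h : ((0 : L2), k) ∈ (preMinOp q).graph.adjoint := by
    rw [Submodule.mem_adjoint_iff]
    intro f f' hf
    rw [inner_zero_right, zero_sub, neg_eq_zero]
    exact (Submodule.mem_orthogonal _ _).1 hk f (LinearPMap.mem_domain_of_mem_graph hf)
  rw [hw.adjoint_graph_preMinOp] at h
  exact (maxOp q).graph_fst_eq_zero_snd h rfl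

theorem adjoint_preMinOp : (preMinOp q)† = maxOp q :=
  LinearPMap.eq_of_eq_graph <| by
    rw [LinearPMap.adjoint_graph_eq_graph_adjoint hw.dense_preMinOp_domain,
      hw.adjoint_graph_preMinOp]

end IsBasisPair

section Parity

variable {q : ℝ → ℝ}

theorem coeFn_parity {f : L2} {y : ℝ → ℂ} (h : f =ᵐ[volume] y) :
    parity f =ᵐ[volume] fun x => y (-x) := by
  have hneg := Measure.measurePreserving_neg (volume : Measure ℝ)
  exact (Lp.coeFn_compMeasurePreserving f hneg).trans
    (hneg.quasiMeasurePreserving.ae_eq_comp h)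

theorem parity_parity (f : L2) : parity (parity f) = f := by
  refine Lp.ext ?_
  simpa only [neg_neg] using coeFn_parity (coeFn_parity (ae_eq_refl f))

theorem parity_mem_maxOp_domain (hq : ∀ x, q (-x) = q x) (f : (maxOp q).domain) :
    parity f ∈ (maxOp q).domain :=
  mem_maxOp_domain ((isMaxFun_continuousRep f).comp_neg hq) (coeFn_parity (ae_eq_continuousRep f))

/-- The parity operator on the domain of the maximal operator. -/
def domainParity (hq : ∀ x, q (-x) = q x) (f : (maxOp q).domain) : (maxOp q).domain :=
  ⟨parity f, parity_mem_maxOp_domain hq f⟩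

theorem continuousRep_domainParity (hq : ∀ x, q (-x) = q x) (f : (maxOp q).domain) :
    continuousRep (domainParity hq f) = fun x => continuousRep f (-x) :=
  continuousRep_eq ((isMaxFun_continuousRep f).comp_neg hq) (coeFn_parity (ae_eq_continuousRep f))

theorem maxOp_domainParity (hq : ∀ x, q (-x) = q x) (f : (maxOp q).domain) :
    maxOp q (domainParity hq f) = parity (maxOp q f) := by
  refine Lp.ext ((maxOp_ae_eq_tau _).trans ?_)
  rw [continuousRep_domainParity, tau_comp_neg hq]
  exact (coeFn_parity (maxOp_ae_eq_tau f)).symm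

theorem domainParity_domainParity (hq : ∀ x, q (-x) = q x) (f : (maxOp q).domain) :
    domainParity hq (domainParity hq f) = f :=
  Subtype.ext (parity_parity f)

theorem parityConj_le_maxOp (hq : ∀ x, q (-x) = q x) {T : L2 →ₗ.[ℂ] L2} (hT : T ≤ maxOp q) :
    parityConj T ≤ maxOp q := by
  refine ⟨fun f hf => ?_, fun ⟨f, hf⟩ g hfg => ?_⟩
  · exact parity_parity f ▸ parity_mem_maxOp_domain hq ⟨parity f, hT.1 hf⟩
  · have heq : T ⟨parity f, hf⟩ = maxOp q (domainParity hq g) := hT.2 (congrArg parity hfg)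
    change parity (T ⟨parity f, hf⟩) = maxOp q g
    rw [heq, ← maxOp_domainParity hq, domainParity_domainParity]

/-- The effect of the reflection `x ↦ -x` on the endpoint values. -/
def reflectEndpoints : (Fin 4 → ℂ) →ₗ[ℂ] Fin 4 → ℂ where
  toFun v := ![v 2, -v 3, v 0, -v 1]
  map_add' u v := by
    ext i
    fin_cases i <;> simp [add_comm]
  map_smul' c v := by
    ext i
    fin_cases i <;> simp

theorem involutive_reflectEndpoints : Function.Involutive reflectEndpoints := fun v => by
  ext i
  fin_cases i <;> simp [reflectEndpoints]

theorem reflectEndpoints_mem_span_singleton {u v : Fin 4 → ℂ} :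
    reflectEndpoints v ∈ Submodule.span ℂ {u} ↔ v ∈ Submodule.span ℂ {reflectEndpoints u} := by
  simp only [Submodule.mem_span_singleton, ← map_smul, involutive_reflectEndpoints.eq_iff]

end Parity

section SpanSingleton

variable {K : Type*} [Field K] {a b c d x₁ x₂ y₁ y₂ : K}

theorem mem_span_singleton_iff_of_ne_zero_left (ha : a ≠ 0) :
    ![x₁, x₂, y₁, y₂] ∈ Submodule.span K {![-b, a, -d, c]} ↔
      a * x₁ + b * x₂ = 0 ∧ !![0, -(d / a); 0, c / a].mulVec ![x₁, x₂] = ![y₁, y₂] := by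
  simp only [Submodule.mem_span_singleton, Matrix.smul_cons, Matrix.smul_empty, smul_eq_mul,
    Matrix.vecCons_inj, and_true, Matrix.cons_mulVec, Matrix.cons_dotProduct_cons,
    Matrix.dotProduct_of_isEmpty, Matrix.empty_mulVec, zero_mul, zero_add, add_zero]
  constructor
  · rintro ⟨t, rfl, rfl, rfl, rfl⟩
    exact ⟨by ring, by field, by field⟩
  · rintro ⟨hx, rfl, rfl⟩
    refine ⟨x₂ / a, ?_, by field, by field, by field⟩
    field_simp
    linear_combination -hx

theorem mem_span_singleton_iff_of_ne_zero_right (hb : b ≠ 0) :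
    ![x₁, x₂, y₁, y₂] ∈ Submodule.span K {![-b, a, -d, c]} ↔
      a * x₁ + b * x₂ = 0 ∧ !![d / b, 0; -(c / b), 0].mulVec ![x₁, x₂] = ![y₁, y₂] := by
  simp only [Submodule.mem_span_singleton, Matrix.smul_cons, Matrix.smul_empty, smul_eq_mul,
    Matrix.vecCons_inj, and_true, Matrix.cons_mulVec, Matrix.cons_dotProduct_cons,
    Matrix.dotProduct_of_isEmpty, Matrix.empty_mulVec, zero_mul, add_zero]
  constructor
  · rintro ⟨t, rfl, rfl, rfl, rfl⟩
    exact ⟨by ring, by field, by field⟩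
  · rintro ⟨hx, rfl, rfl⟩
    refine ⟨-(x₁ / b), by field, ?_, by field, by field⟩
    field_simp
    linear_combination -hx

theorem mem_span_singleton_swap {u₁ u₂ v₁ v₂ : K} :
    ![x₁, x₂, y₁, y₂] ∈ Submodule.span K {![u₁, u₂, v₁, v₂]} ↔
      ![y₁, y₂, x₁, x₂] ∈ Submodule.span K {![v₁, v₂, u₁, u₂]} := by
  simp only [Submodule.mem_span_singleton, Matrix.smul_cons, Matrix.smul_empty,
    Matrix.vecCons_inj, and_true]
  exact exists_congr fun t => by tauto

end SpanSingleton

/-- The endpoint values whose pairing through `endpointForm` with those of `f` is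
`a α₁(f) + b α₂(f) - c β₁(f) - d β₂(f)`. -/
def conormal (a b c d : ℂ) : Fin 4 → ℂ :=
  ![-conj b, conj a, -conj d, conj c]

theorem endpointForm_conormal (a b c d : ℂ) (v : Fin 4 → ℂ) :
    endpointForm (conormal a b c d) v = 0 ↔ a * v 0 + b * v 1 = c * v 2 + d * v 3 := by
  rw [← sub_eq_zero (a := a * v 0 + _), endpointForm_apply]
  simp only [conormal, Matrix.cons_val, map_neg, starRingEnd_self_apply]
  ring_nf

theorem conormal_ne_zero {a b c d : ℂ} (h : ‖a‖ + ‖b‖ + ‖c‖ + ‖d‖ ≠ 0) :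
    conormal a b c d ≠ 0 := by
  contrapose! h
  obtain ⟨rfl, rfl, rfl, rfl⟩ : a = 0 ∧ b = 0 ∧ c = 0 ∧ d = 0 := by
    simpa [conormal, and_assoc, and_comm, and_left_comm] using h
  simp only [norm_zero, add_zero]

theorem span_reflectEndpoints_conormal (a b c d : ℂ) :
    Submodule.span ℂ {reflectEndpoints (conormal a b c d)} =
      Submodule.span ℂ {conormal c (-d) a (-b)} := by
  have h : reflectEndpoints (conormal a b c d) = -conormal c (-d) a (-b) := by
    ext i
    fin_cases i <;> simp [reflectEndpoints, conormal]
  rw [h, ← Set.neg_singleton, Submodule.span_neg]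

namespace IsBasisPair

variable {q : ℝ → ℝ} {w₁ w₂ : ℝ → ℂ} (hw : IsBasisPair q w₁ w₂)

/-- The boundary map of the Sturm–Liouville operator, given by the endpoint values. -/
def boundaryMap : (maxOp q).domain →ₗ[ℂ] Fin 4 → ℂ where
  toFun f := endpointValues w₁ w₂ (continuousRep f)
  map_add' f g := by
    rw [continuousRep_add,
      hw.endpointValues_add (isMaxFun_continuousRep f) (isMaxFun_continuousRep g)]
  map_smul' c f := by
    rw [continuousRep_smul, hw.endpointValues_smul c (isMaxFun_continuousRep f), RingHom.id_apply]

theorem boundaryMap_apply (f : (maxOp q).domain) :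
    hw.boundaryMap f = endpointValues w₁ w₂ (continuousRep f) :=
  rfl

theorem isBoundaryMap : IsBoundaryMap (preMinOp q) (maxOp q) hw.boundaryMap endpointForm where
  dense := hw.dense_preMinOp_domain
  le := preMinOp_le_maxOp
  adjoint_eq := hw.adjoint_preMinOp
  green f g := by
    rw [inner_maxOp_sub_inner_maxOp,
      hw.bvTop_sub_bvBot (isMaxFun_continuousRep f) (isMaxFun_continuousRep g)]
    rfl
  surjective v := by
    obtain ⟨y, hy, rfl⟩ := hw.exists_endpointValues_eq v
    exact ⟨hy.toDomain, by rw [boundaryMap_apply, continuousRep_toDomain]⟩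
  nondegenerate := nondegenerate_endpointForm

theorem boundaryMap_domainParity (hq : ∀ x, q (-x) = q x) (f : (maxOp q).domain) :
    hw.boundaryMap (domainParity hq f) = reflectEndpoints (hw.boundaryMap f) := by
  rw [boundaryMap_apply, continuousRep_domainParity,
    hw.endpointValues_comp_neg (isMaxFun_continuousRep f)]
  rfl

/-- The extension of the minimal operator whose domain consists of the functions with endpoint
values in the line spanned by `u`. -/
def lineExtension (u : Fin 4 → ℂ) : L2 →ₗ.[ℂ] L2 :=
  restrictBoundary (maxOp q) hw.boundaryMap (Submodule.span ℂ {u})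

theorem lineExtension_domain (u : Fin 4 → ℂ) : ((hw.lineExtension u).domain : Set L2) =
    maxDomainWhere q fun f => endpointValues w₁ w₂ f ∈ Submodule.span ℂ {u} := by
  ext f
  rw [SetLike.mem_coe, mem_maxDomainWhere]
  exact mem_restrictBoundary_domain

include hw in
theorem adjoint_minOp : (minOp q)† = maxOp q :=
  hw.isBoundaryMap.adjoint_closure

theorem adjoint_eq_lineExtension {T : L2 →ₗ.[ℂ] L2} (hT : T ≤ maxOp q) {u : Fin 4 → ℂ}
    (hdom : (T.domain : Set L2) =
      maxDomainWhere q fun f => endpointForm u (endpointValues w₁ w₂ f) = 0) :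
    T† = hw.lineExtension u := by
  have hT' : T = restrictBoundary (maxOp q) hw.boundaryMap
      ((Submodule.span ℂ {u}).orthogonalBilin endpointForm) :=
    eq_restrictBoundary hT fun f => by
      rw [← SetLike.mem_coe, hdom, mem_maxDomainWhere]
      simp only [mem_orthogonalBilin_span_singleton, boundaryMap_apply]
  rw [hT', hw.isBoundaryMap.adjoint_restrictBoundary, orthogonalBilin_orthogonalBilin_span_singleton
    isRefl_endpointForm nondegenerate_endpointForm.1, lineExtension]

theorem isClosed_lineExtension (u : Fin 4 → ℂ) : (hw.lineExtension u).IsClosed := by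
  rw [lineExtension, ← orthogonalBilin_orthogonalBilin_span_singleton
    isRefl_endpointForm nondegenerate_endpointForm.1, ← hw.isBoundaryMap.adjoint_restrictBoundary]
  exact LinearPMap.adjoint_isClosed (hw.isBoundaryMap.dense_restrictBoundary _)

theorem isBiExtension_lineExtension {u : Fin 4 → ℂ} (hu : u ≠ 0) :
    IsBiExtension (minOp q) (hw.lineExtension u) 1 where
  closed := hw.isClosed_lineExtension u
  le := by
    rw [minOp, hw.isBoundaryMap.closure_eq]
    exact restrictBoundary_mono bot_le
  le_adjoint := by
    rw [hw.adjoint_minOp]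
    exact restrictBoundary_le
  rank_eq := by
    rw [minOp, hw.isBoundaryMap.closure_eq, lineExtension,
      (restrictBoundaryQuotEquiv hw.isBoundaryMap.surjective _).rank_eq,
      ← Module.finrank_eq_rank, finrank_span_singleton hu]

theorem parityConj_lineExtension (hq : ∀ x, q (-x) = q x) (u : Fin 4 → ℂ) :
    parityConj (hw.lineExtension u) = hw.lineExtension (reflectEndpoints u) := by
  refine eq_restrictBoundary (parityConj_le_maxOp hq restrictBoundary_le) fun f => ?_
  have hparity (hf : f ∈ (maxOp q).domain) :
      hw.boundaryMap ⟨parity f, parity_mem_maxOp_domain hq ⟨f, hf⟩⟩ ∈ Submodule.span ℂ {u} ↔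
        hw.boundaryMap ⟨f, hf⟩ ∈ Submodule.span ℂ {reflectEndpoints u} := by
    rw [← reflectEndpoints_mem_span_singleton, ← hw.boundaryMap_domainParity hq, domainParity]
  refine (mem_restrictBoundary_domain (f := parity f)).trans
    ⟨fun ⟨hPf, h⟩ => ?_, fun ⟨hf, h⟩ => ⟨_, (hparity hf).2 h⟩⟩
  have hf : f ∈ (maxOp q).domain := (parityConj_le_maxOp hq le_rfl).1 hPf
  exact ⟨hf, (hparity hf).1 h⟩

theorem parityConj_lineExtension_conormal (hq : ∀ x, q (-x) = q x) (a b c d : ℂ) :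
    parityConj (hw.lineExtension (conormal a b c d)) =
      hw.lineExtension (conormal c (-d) a (-b)) := by
  rw [hw.parityConj_lineExtension hq, lineExtension, span_reflectEndpoints_conormal, lineExtension]

section ExplicitDomain

variable (a b c d : ℂ)

theorem lineExtension_conormal_domain_of_ne_zero₁ (ha : a ≠ 0) :
    ((hw.lineExtension (conormal a b c d)).domain : Set L2) = maxDomainWhere q fun g =>
      conj a * bvBot w₁ g + conj b * bvBot w₂ g = 0 ∧
      !![0, -(conj d / conj a); 0, conj c / conj a].mulVec ![bvBot w₁ g, bvBot w₂ g]
        = ![bvTop w₁ g, bvTop w₂ g] := by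
  rw [lineExtension_domain]
  exact congrArg _ <| funext fun g => propext <|
    mem_span_singleton_iff_of_ne_zero_left ((map_ne_zero _).2 ha)

theorem lineExtension_conormal_domain_of_ne_zero₂ (hb : b ≠ 0) :
    ((hw.lineExtension (conormal a b c d)).domain : Set L2) = maxDomainWhere q fun g =>
      conj a * bvBot w₁ g + conj b * bvBot w₂ g = 0 ∧
      !![conj d / conj b, 0; -(conj c / conj b), 0].mulVec ![bvBot w₁ g, bvBot w₂ g]
        = ![bvTop w₁ g, bvTop w₂ g] := by
  rw [lineExtension_domain]
  exact congrArg _ <| funext fun g => propext <|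
    mem_span_singleton_iff_of_ne_zero_right ((map_ne_zero _).2 hb)

theorem lineExtension_conormal_domain_of_ne_zero₃ (hc : c ≠ 0) :
    ((hw.lineExtension (conormal a b c d)).domain : Set L2) = maxDomainWhere q fun g =>
      conj c * bvTop w₁ g + conj d * bvTop w₂ g = 0 ∧
      !![0, -(conj b / conj c); 0, conj a / conj c].mulVec ![bvTop w₁ g, bvTop w₂ g]
        = ![bvBot w₁ g, bvBot w₂ g] := by
  rw [lineExtension_domain]
  exact congrArg _ <| funext fun g => propext <| mem_span_singleton_swap.trans <|
    mem_span_singleton_iff_of_ne_zero_left ((map_ne_zero _).2 hc)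

theorem lineExtension_conormal_domain_of_ne_zero₄ (hd : d ≠ 0) :
    ((hw.lineExtension (conormal a b c d)).domain : Set L2) = maxDomainWhere q fun g =>
      conj c * bvTop w₁ g + conj d * bvTop w₂ g = 0 ∧
      !![conj b / conj d, 0; -(conj a / conj d), 0].mulVec ![bvTop w₁ g, bvTop w₂ g]
        = ![bvBot w₁ g, bvBot w₂ g] := by
  rw [lineExtension_domain]
  exact congrArg _ <| funext fun g => propext <| mem_span_singleton_swap.trans <|
    mem_span_singleton_iff_of_ne_zero_right ((map_ne_zero _).2 hd)

end ExplicitDomain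

end IsBasisPair

end

end PTExt

theorem mainTheorem9
    (q : ℝ → ℝ) (hq : Admissible q)
    (w₁ w₂ : ℝ → ℂ) (hw : IsBasisPair q w₁ w₂)
    (T : L2 →ₗ.[ℂ] L2) (hT : IsBiExtension (minOp q) T 3)
    (a b c d : ℂ) (habcd : ‖a‖ + ‖b‖ + ‖c‖ + ‖d‖ ≠ 0)
    (hdom : (T.domain : Set L2) = maxDomainWhere q fun f =>
      a * bvBot w₁ f + b * bvBot w₂ f = c * bvTop w₁ f + d * bvTop w₂ f) :
    IsBiExtension (minOp q) T† 1 ∧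
    IsBiExtension (minOp q) (kreinAdjoint T) 1 ∧
    (a ≠ 0 →
      (T†.domain : Set L2) = maxDomainWhere q (fun g =>
        conj a * bvBot w₁ g + conj b * bvBot w₂ g = 0 ∧
        !![0, -(conj d / conj a); 0, conj c / conj a].mulVec ![bvBot w₁ g, bvBot w₂ g]
          = ![bvTop w₁ g, bvTop w₂ g]) ∧
      ((kreinAdjoint T).domain : Set L2) = maxDomainWhere q (fun h =>
        conj a * bvTop w₁ h - conj b * bvTop w₂ h = 0 ∧
        !![0, conj d / conj a; 0, conj c / conj a].mulVec ![bvTop w₁ h, bvTop w₂ h]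
          = ![bvBot w₁ h, bvBot w₂ h])) ∧
    (b ≠ 0 →
      (T†.domain : Set L2) = maxDomainWhere q (fun g =>
        conj a * bvBot w₁ g + conj b * bvBot w₂ g = 0 ∧
        !![conj d / conj b, 0; -(conj c / conj b), 0].mulVec ![bvBot w₁ g, bvBot w₂ g]
          = ![bvTop w₁ g, bvTop w₂ g]) ∧
      ((kreinAdjoint T).domain : Set L2) = maxDomainWhere q (fun h =>
        conj a * bvTop w₁ h - conj b * bvTop w₂ h = 0 ∧
        !![conj d / conj b, 0; conj c / conj b, 0].mulVec ![bvTop w₁ h, bvTop w₂ h]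
          = ![bvBot w₁ h, bvBot w₂ h])) ∧
    (c ≠ 0 →
      (T†.domain : Set L2) = maxDomainWhere q (fun g =>
        conj c * bvTop w₁ g + conj d * bvTop w₂ g = 0 ∧
        !![0, -(conj b / conj c); 0, conj a / conj c].mulVec ![bvTop w₁ g, bvTop w₂ g]
          = ![bvBot w₁ g, bvBot w₂ g]) ∧
      ((kreinAdjoint T).domain : Set L2) = maxDomainWhere q (fun h =>
        conj c * bvBot w₁ h - conj d * bvBot w₂ h = 0 ∧
        !![0, conj b / conj c; 0, conj a / conj c].mulVec ![bvBot w₁ h, bvBot w₂ h]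
          = ![bvTop w₁ h, bvTop w₂ h])) ∧
    (d ≠ 0 →
      (T†.domain : Set L2) = maxDomainWhere q (fun g =>
        conj c * bvTop w₁ g + conj d * bvTop w₂ g = 0 ∧
        !![conj b / conj d, 0; -(conj a / conj d), 0].mulVec ![bvTop w₁ g, bvTop w₂ g]
          = ![bvBot w₁ g, bvBot w₂ g]) ∧
      ((kreinAdjoint T).domain : Set L2) = maxDomainWhere q (fun h =>
        conj c * bvBot w₁ h - conj d * bvBot w₂ h = 0 ∧
        !![conj b / conj d, 0; conj a / conj d, 0].mulVec ![bvBot w₁ h, bvBot w₂ h]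
          = ![bvTop w₁ h, bvTop w₂ h])) := by
  have hTle : T ≤ maxOp q := hw.adjoint_minOp ▸ hT.le_adjoint
  have hadj : T† = hw.lineExtension (conormal a b c d) := by
    refine hw.adjoint_eq_lineExtension hTle (hdom.trans ?_)
    simp only [endpointForm_conormal]
    rfl
  have hkrein : kreinAdjoint T = hw.lineExtension (conormal c (-d) a (-b)) := by
    rw [kreinAdjoint, hadj, hw.parityConj_lineExtension_conormal hq.even]
  have hne : conormal c (-d) a (-b) ≠ 0 := conormal_ne_zero <| by
    rwa [norm_neg, norm_neg, add_assoc, add_comm, ← add_assoc]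
  rw [hkrein, hadj]
  refine ⟨hw.isBiExtension_lineExtension (conormal_ne_zero habcd),
    hw.isBiExtension_lineExtension hne,
    fun ha => ⟨hw.lineExtension_conormal_domain_of_ne_zero₁ a b c d ha, ?_⟩,
    fun hb => ⟨hw.lineExtension_conormal_domain_of_ne_zero₂ a b c d hb, ?_⟩,
    fun hc => ⟨hw.lineExtension_conormal_domain_of_ne_zero₃ a b c d hc, ?_⟩,
    fun hd => ⟨hw.lineExtension_conormal_domain_of_ne_zero₄ a b c d hd, ?_⟩⟩
  · simpa only [map_neg, neg_mul, neg_div, div_neg, neg_neg, ← sub_eq_add_neg] using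
      hw.lineExtension_conormal_domain_of_ne_zero₃ c (-d) a (-b) ha
  · simpa only [map_neg, neg_mul, neg_div, div_neg, neg_neg, ← sub_eq_add_neg] using
      hw.lineExtension_conormal_domain_of_ne_zero₄ c (-d) a (-b) (neg_ne_zero.2 hb)
  · simpa only [map_neg, neg_mul, neg_div, div_neg, neg_neg, ← sub_eq_add_neg] using
      hw.lineExtension_conormal_domain_of_ne_zero₁ c (-d) a (-b) hc
  · simpa only [map_neg, neg_mul, neg_div, div_neg, neg_neg, ← sub_eq_add_neg] using
      hw.lineExtension_conormal_domain_of_ne_zero₂ c (-d) a (-b) (neg_ne_zero.2 hd)
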